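/- **Definitions.** Write $\bar x=1/x$, $\sigma(x)=x-\bar x$, $\widehat\sigma(x)=\sigma(x)/\sigma(q^4)$. Let $T_n$ be the triangular grid graph with top vertices $(0,j)$, left boundary vertices $(i,i)$, bulk vertices $(i,j)$ with $i<j$, and right boundary vertices $(i,n+1)$, where $1\le i,j\le n$; row indices increase downwards, column indices increase to the right, and vertices adjacent in a row or column are joined by an edge (so each left boundary vertex has only an upper and a right edge). Let $\mathrm{6V}(n)$ be the set of orientations of the edges of $T_n$ in which every bulk vertex has two incoming and two outgoing edges, every edge at a top vertex points upward and every edge at a right boundary vertex points leftward. Give a bulk vertex $(i,j)$ the weight - $1$ if its two horizontal edges both point towards it or both point away from it, - $\widehat\sigma(q^2u_iu_j)$ if its edges point (up and right) or (down and left), - $\widehat\sigma(q^2\bar u_i\bar u_j)$ if its edges point (up and left) or (down and right), and give a left boundary vertex $(i,i)$ the weight - $(\alpha qu_i+\beta\bar q\bar u_i)\phi(u_i)$ if its upper edge points up and its right edge points left, - $(\alpha\bar q\bar u_i+\beta qu_i)\phi(u_i)$ if its upper edge points down and its right edge points right, - $\delta\,\sigma(q^2u_i^2)\phi(u_i)$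 if both edges point towards it, - $\gamma\,\sigma(q^2u_i^2)\phi(u_i)$ if both edges point away from it. The DSASM partition function $Z_n(u_1,\dots,u_n)$ is the sum over all $C\in\mathrm{6V}(n)$ of the product of the weights of all bulk and left boundary vertices, and $\widetilde Z_n(u_1,\dots,u_n)$ is its specialization at $\alpha=\beta=s$, $\gamma=\delta=1/\sigma(q)$, $\phi(u_i)=1/(qu_i+\bar q\bar u_i)$. **Statement.** Let $n\ge 0$, let $u_1,\dots,u_n$ be indeterminates, let $i=\sqrt{-1}$, and let $q\in\mathbb C$ satisfy $q^2+\bar q^2=1$. Put $\varepsilon=1$ if $\operatorname{Im}(q^2)>0$ (that is, $q=\pm e^{i\pi/6}$) and $\varepsilon=-1$ otherwise (that is, $q=\pm e^{-i\pi/6}$). Then $\widetilde Z_{2n+1}(u_1,\dots,u_n,\bar u_1,\dots,\bar u_n,1)$ is a polynomial in $s$ over $\mathbb C(u_1,\dots,u_n)$ that is divisible by $s$, and $$\Bigl(\widetilde Z_{2n+1}(u_1,\dots,u_n,\bar u_1,\dots,\bar u_n,1)/s\Bigr)\Big|_{s=0}=\varepsilon\,3^{(2n-1)/2}\prod_{k=1}^n\frac{(u_k+\bar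 u_k)^2}{(u_k^2+\bar u_k^2-1)^2}\;\widetilde Z_{2n+2}(u_1,\dots,u_n,\bar u_1,\dots,\bar u_n,1,i)\Big|_{s=0}.$$ In particular, with the usual choice $q-\bar q=i$, $q+\bar q=\sqrt3$ one has $\varepsilon=1$. -/

import Mathlib

/-- Orientations of a vertical edge. -/
inductive VDir
  | up
  | down
  deriving DecidableEq

instance : Fintype VDir :=
  ⟨{VDir.up, VDir.down}, fun x => by cases x <;> simp⟩

/-- Orientations of a horizontal edge. -/
inductive HDir
  | left
  | right
  deriving DecidableEq

instance : Fintype HDir :=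
  ⟨{HDir.left, HDir.right}, fun x => by cases x <;> simp⟩

/-- The left boundary vertices `(i, i)` and the bulk vertices `(i, j)`, `i < j`, of the triangular
grid graph `T_n` (rows are numbered downwards, columns from left to right, both starting at `0`). -/
abbrev TVertex (n : ℕ) := {p : Fin n × Fin n // p.1 ≤ p.2}

/-- An orientation of all edges of `T_n`. Every vertical edge is the edge directly above exactly one
vertex `(i, j)`, `i ≤ j` (for the first row it ends in a top vertex), and every horizontal edge is
the edge directly to the right of exactly one vertex `(i, j)`, `i ≤ j` (for the last column it
ends in a right boundary vertex). -/
abbrev EdgeOrientation (n : ℕ) := (TVertex n → VDir) × (TVertex n → HDir)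

namespace EdgeOrientation

variable {n : ℕ}

/-- The edge above `(i, j)`, where `i ≤ j`. -/
def above (C : EdgeOrientation n) (i j : Fin n) (h : i ≤ j) : VDir := C.1 ⟨(i, j), h⟩

/-- The edge to the right of `(i, j)`, where `i ≤ j`. -/
def rightOf (C : EdgeOrientation n) (i j : Fin n) (h : i ≤ j) : HDir := C.2 ⟨(i, j), h⟩

/-- The edge below the bulk vertex `(i, j)`, `i < j`: it is the edge above `(i + 1, j)`. -/
def below (C : EdgeOrientation n) (i j : Fin n) (h : i < j) : VDir :=
  C.above ⟨i.1 + 1, lt_of_le_of_lt (Nat.succ_le_of_lt h) j.2⟩ j (Nat.succ_le_of_lt h)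

/-- The edge to the left of the bulk vertex `(i, j)`, `i < j`: it is the edge to the right
of `(i, j - 1)`. -/
def leftOf (C : EdgeOrientation n) (i j : Fin n) (h : i < j) : HDir :=
  C.rightOf i ⟨j.1 - 1, lt_of_le_of_lt (Nat.sub_le _ _) j.2⟩ (Nat.le_sub_one_of_lt h)

end EdgeOrientation

/-- The number of incoming edges at a vertex whose incident edges above, below, left and right
are oriented as given. -/
def incomingCount (a b : VDir) (l r : HDir) : ℕ :=
  (if a = VDir.down then 1 else 0) + (if b = VDir.up then 1 else 0) +
    (if l = HDir.right then 1 else 0) + (if r = HDir.left then 1 else 0)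

/-- The six-vertex configurations on `T_n`: each bulk vertex (which has four edges) has two incoming
and two outgoing edges, each edge at a top vertex is directed upward, and each edge at a right
boundary vertex is directed leftward. -/
def IsSixVertex {n : ℕ} (C : EdgeOrientation n) : Prop :=
  (∀ (i j : Fin n) (h : i < j),
    incomingCount (C.above i j h.le) (C.below i j h) (C.leftOf i j h) (C.rightOf i j h.le) = 2) ∧
  (∀ (i j : Fin n) (h : i ≤ j), i.1 = 0 → C.above i j h = VDir.up) ∧
  (∀ (i j : Fin n) (h : i ≤ j), j.1 + 1 = n → C.rightOf i j h = HDir.left)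

open Classical in
/-- The finite set `6V(n)` of six-vertex configurations on `T_n`. -/
noncomputable def sixV (n : ℕ) : Finset (EdgeOrientation n) :=
  Finset.univ.filter IsSixVertex

section Weights

variable {K : Type*} [Field K]

/-- `σ(x) = x - 1/x`. -/
def sigmaFn (x : K) : K := x - x⁻¹

/-- `σ̂(x) = σ(x) / σ(q⁴)`. -/
def sigmaHat (q x : K) : K := sigmaFn x / sigmaFn (q ^ 4)

/-- Bulk weight of a local configuration, given by the edges above, below, left and right, with
parameter `x = u_i u_j`. The last case does not occur in a six-vertex configuration. -/
def bulkWeight (q : K) (a b : VDir) (l r : HDir) (x : K) : K :=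
  match a, b, l, r with
  | .up, .down, .right, .left => 1
  | .down, .up, .left, .right => 1
  | .up, .up, .right, .right => sigmaHat q (q ^ 2 * x)
  | .down, .down, .left, .left => sigmaHat q (q ^ 2 * x)
  | .up, .up, .left, .left => sigmaHat q (q ^ 2 * x⁻¹)
  | .down, .down, .right, .right => sigmaHat q (q ^ 2 * x⁻¹)
  | _, _, _, _ => 0

/-- Left boundary weight of a local configuration, given by the edges above and to the right, with
parameter `x = u_i`. -/
def leftWeight (q α β γ δ : K) (φ : K → K) (a : VDir) (r : HDir) (x : K) : K :=
  match a, r with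
  | .up, .left => (α * q * x + β * q⁻¹ * x⁻¹) * φ x
  | .down, .right => (α * q⁻¹ * x⁻¹ + β * q * x) * φ x
  | .down, .left => δ * sigmaFn (q ^ 2 * x ^ 2) * φ x
  | .up, .right => γ * sigmaFn (q ^ 2 * x ^ 2) * φ x

/-- The DSASM partition function `Z_n(u_1, …, u_n)`. -/
noncomputable def dsasmZ (n : ℕ) (q α β γ δ : K) (φ : K → K) (u : Fin n → K) : K :=
  ∑ C ∈ sixV n,
    (∏ i : Fin n, leftWeight q α β γ δ φ (C.above i i le_rfl) (C.rightOf i i le_rfl) (u i)) *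
    ∏ i : Fin n, ∏ j : Fin n,
      if h : i < j then
        bulkWeight q (C.above i j h.le) (C.below i j h) (C.leftOf i j h) (C.rightOf i j h.le)
          (u i * u j)
      else 1

/-- The specialized DSASM partition function `Z̃_n(u_1, …, u_n)`: here `α = β = s`,
`γ = δ = 1/σ(q)` and `φ(x) = 1/(q x + q⁻¹ x⁻¹)`. -/
noncomputable def specZ (n : ℕ) (q s : K) (u : Fin n → K) : K :=
  dsasmZ n q s s (1 / sigmaFn q) (1 / sigmaFn q) (fun x => 1 / (q * x + q⁻¹ * x⁻¹)) u

/-- The sequence `u_1, …, u_n, 1/u_1, …, 1/u_n, 1`. -/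
def oddArgs {n : ℕ} (u : Fin n → K) : Fin (n + n + 1) → K :=
  Fin.snoc (α := fun _ => K) (Fin.append u fun i => (u i)⁻¹) 1

/-- The sequence `u_1, …, u_n, 1/u_1, …, 1/u_n, 1, c`. -/
def evenArgs {n : ℕ} (u : Fin n → K) (c : K) : Fin (n + n + 1 + 1) → K :=
  Fin.snoc (α := fun _ => K) (oddArgs u) c

end Weights

/-- The field `ℂ(u_1, …, u_n)` of rational functions in `n` indeterminates. -/
abbrev RatField (n : ℕ) := FractionRing (MvPolynomial (Fin n) ℂ)

/-- The indeterminate `u_i` as an element of `ℂ(u_1, …, u_n)`. -/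
noncomputable def indet (n : ℕ) (i : Fin n) : RatField n :=
  algebraMap (MvPolynomial (Fin n) ℂ) (RatField n) (MvPolynomial.X i)

/-! Read row by row, the partition function becomes `topZ`; once φ is cancelled, the boundary
weights are s on the diagonal and σ(qu)/σ(q) off it. Replacing s by an indeterminate X gives
`polyZ`. Its constant coefficient is a product of boundary weights times `offZ`, the model without
diagonal boundary weights, which vanishes in odd order. So s divides the odd partition function, and
the claim compares the linear coefficient `linZ` at (u, ū, 1) with `offZ` at (u, ū, 1, i).

The Yang–Baxter and reflection equations make `topZ` symmetric in its parameters (`topZ_perm`). At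
zeros of a bulk weight part of the configuration freezes or cancels, and two parameters drop out
(`topZ_cons_append`, `topZ_cons_cons`).

The core is `linSum_eq`: for 2m+1 generic parameters, ∏σ(q/u)·linZ(u) + ∏σ(qu)·linZ(ū) equals (-3)^m
σ(q) ∏(u+ū)·offZ(i, u). Both sides are Laurent polynomials of the same degree in the first parameter
x, and they agree at sufficiently many points. At x = q²/w both satisfy the same recursion, because
q²+q̄² = 1 forces σ(q)² = -1 and σ(q⁴)² = -3 and turns the bulk weights with parameter i into
multiples of σ(q/z). At x = q and x = q̄ both collapse to `offZ`.

The sequence (u, ū, 1) is closed under inversion, so there the two summands coincide and the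
identity determines `linZ`. Finally σ(qi)/σ(q) = ε√3 converts 3^n into ε·3^((2n-1)/2). -/

/-! ### Row transfer operators and local weights -/

section Transfer

variable {K M N : Type*} [Field K] [AddCommGroup M] [Module K M] [AddCommGroup N] [Module K N]

/-- The bulk weight `σ̂(q²x)`. -/
def wtA (q x : K) : K := sigmaHat q (q ^ 2 * x)

/-- The bulk weight `σ̂(q²/x)`. -/
def wtB (q x : K) : K := sigmaHat q (q ^ 2 * x⁻¹)

/-- The transfer operator of one row of bulk vertices with row parameter `u` and column parameters
`vs`: `r` is the leftmost horizontal edge, `as` are the edges above the row, and the sum runs over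
the edges below the row, on which `G` is evaluated. The rightmost horizontal edge points left. -/
def rowOp (q u : K) : HDir → List K → List VDir → (List VDir → M) → M
  | .left, [], [], G => G []
  | .right, v :: vs, .up :: as, G =>
      rowOp q u .left vs as (fun bs => G (.down :: bs)) +
        wtA q (u * v) • rowOp q u .right vs as (fun bs => G (.up :: bs))
  | .left, v :: vs, .up :: as, G => wtB q (u * v) • rowOp q u .left vs as (fun bs => G (.up :: bs))
  | .right, v :: vs, .down :: as, G =>
      wtB q (u * v) • rowOp q u .right vs as (fun bs => G (.down :: bs))
  | .left, v :: vs, .down :: as, G =>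
      rowOp q u .right vs as (fun bs => G (.up :: bs)) +
        wtA q (u * v) • rowOp q u .left vs as (fun bs => G (.down :: bs))
  | _, _, _, _ => 0

variable (q u v : K) (r : HDir) (vs : List K) (as : List VDir) (G : List VDir → M)

@[simp] theorem rowOp_left_nil_nil : rowOp q u .left [] [] G = G [] := rfl

@[simp] theorem rowOp_right_nil : rowOp q u .right [] as G = 0 := by cases as <;> rfl

@[simp] theorem rowOp_cons_nil : rowOp q u r (v :: vs) [] G = 0 := by cases r <;> rfl

@[simp] theorem rowOp_nil_cons (a : VDir) : rowOp q u r [] (a :: as) G = 0 := by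
  cases r <;> cases a <;> rfl

@[simp] theorem rowOp_right_up : rowOp q u .right (v :: vs) (.up :: as) G =
    rowOp q u .left vs as (fun bs => G (.down :: bs)) +
      wtA q (u * v) • rowOp q u .right vs as (fun bs => G (.up :: bs)) := rfl

@[simp] theorem rowOp_left_up : rowOp q u .left (v :: vs) (.up :: as) G =
    wtB q (u * v) • rowOp q u .left vs as (fun bs => G (.up :: bs)) := rfl

@[simp] theorem rowOp_right_down : rowOp q u .right (v :: vs) (.down :: as) G =
    wtB q (u * v) • rowOp q u .right vs as (fun bs => G (.down :: bs)) := rfl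

@[simp] theorem rowOp_left_down : rowOp q u .left (v :: vs) (.down :: as) G =
    rowOp q u .right vs as (fun bs => G (.up :: bs)) +
      wtA q (u * v) • rowOp q u .left vs as (fun bs => G (.down :: bs)) := rfl

/-- The transfer operator commutes with linear maps. -/
theorem map_rowOp (f : M →ₗ[K] N) : ∀ (r : HDir) (vs : List K) (as : List VDir)
    (G : List VDir → M), f (rowOp q u r vs as G) = rowOp q u r vs as (fun bs => f (G bs))
  | .left, [], [], G => rfl
  | .right, [], as, G => by simp
  | .left, [], a :: as, G => by simp
  | r, v :: vs, [], G => by simp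
  | r, v :: vs, a :: as, G => by cases r <;> cases a <;> simp [map_rowOp f _ vs as]

theorem rowOp_add : ∀ (r : HDir) (vs : List K) (as : List VDir) (G H : List VDir → M),
    rowOp q u r vs as (fun bs => G bs + H bs) = rowOp q u r vs as G + rowOp q u r vs as H
  | .left, [], [], G, H => rfl
  | .right, [], as, G, H => by simp
  | .left, [], a :: as, G, H => by simp
  | r, v :: vs, [], G, H => by simp
  | r, v :: vs, a :: as, G, H => by
    cases r <;> cases a <;> simp [rowOp_add _ vs as] <;> abel

theorem rowOp_smul (c : K) :
    rowOp q u r vs as (fun bs => c • G bs) = c • rowOp q u r vs as G :=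
  (map_rowOp q u (c • LinearMap.id (R := K) (M := M)) r vs as G).symm

/-- The Yang–Baxter weights `1, σ̂(v₁/v₂), σ̂(q⁴v₂/v₁)`, as relations between the bulk weights. -/
theorem wt_exchange {q u v w : K} (hq : q ≠ 0) (hd : sigmaFn (q ^ 4) ≠ 0) (hu : u ≠ 0)
    (hv : v ≠ 0) (hw : w ≠ 0) :
    sigmaHat q (q ^ 4 * (w / v)) * wtB q (u * w) =
        wtB q (u * v) + wtA q (u * w) * sigmaHat q (v / w) ∧
      sigmaHat q (q ^ 4 * (w / v)) * wtA q (u * v) =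
        wtA q (u * w) + wtB q (u * v) * sigmaHat q (v / w) := by
  simp only [wtA, wtB, sigmaHat]
  constructor
  all_goals
    field_simp
    simp only [sigmaFn]
    field_simp
    ring

end Transfer

/-! ### Yang–Baxter equation for two rows -/

section Exchange

variable {K M : Type*} [Field K] [AddCommGroup M] [Module K M]

/-- The third component of the local Yang–Baxter relation. With `wt_exchange` it is all that the row
and column exchanges need to know about the weights. -/
theorem wt_exchange' {q u v w : K} (hq : q ≠ 0) (hd : sigmaFn (q ^ 4) ≠ 0) (hu : u ≠ 0)
    (hv : v ≠ 0) (hw : w ≠ 0) :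
    wtA q (u * v) * wtB q (u * w) = sigmaHat q (v / w) + wtA q (u * w) * wtB q (u * v) := by
  simp only [wtA, wtB, sigmaHat]
  field_simp
  simp only [sigmaFn]
  field_simp
  ring

/-- Two consecutive rows of the transfer operator, with row parameters `v` and `w`. -/
abbrev twoRow (q v w : K) (r t : HDir) (vs : List K) (as : List VDir) (G : List VDir → M) : M :=
  rowOp q v r vs as fun bs => rowOp q w t vs bs G

variable {q v w : K}

/-- The Yang–Baxter equation for two rows. -/
theorem twoRow_exchange (hq : q ≠ 0) (hd : sigmaFn (q ^ 4) ≠ 0) (hv : v ≠ 0) (hw : w ≠ 0) :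
    ∀ (vs : List K) (as : List VDir) (G : List VDir → M), (∀ x ∈ vs, x ≠ 0) →
    sigmaHat q (q ^ 4 * (w / v)) • twoRow q v w .left .left vs as G =
      sigmaHat q (q ^ 4 * (w / v)) • twoRow q w v .left .left vs as G ∧
    sigmaHat q (q ^ 4 * (w / v)) • twoRow q v w .right .right vs as G =
      sigmaHat q (q ^ 4 * (w / v)) • twoRow q w v .right .right vs as G ∧
    twoRow q v w .left .right vs as G + sigmaHat q (v / w) • twoRow q v w .right .left vs as G =
      sigmaHat q (q ^ 4 * (w / v)) • twoRow q w v .left .right vs as G ∧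
    twoRow q v w .right .left vs as G + sigmaHat q (v / w) • twoRow q v w .left .right vs as G =
      sigmaHat q (q ^ 4 * (w / v)) • twoRow q w v .right .left vs as G
  -- Both rows end in left-pointing edges, so past the last column the additional vertex acts as the
  -- scalar `sigmaHat q (q ^ 4 * (w / v))`.
  | [], [], G, _ => by simp [twoRow]
  | [], a :: as, G, _ => by simp [twoRow]
  | x :: vs, [], G, _ => by simp [twoRow]
  | x :: vs, a :: as, G, hx => by
    obtain ⟨hx0, hvs⟩ : x ≠ 0 ∧ ∀ y ∈ vs, y ≠ 0 := by simpa using hx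
    obtain ⟨u1, u2, u3, u4⟩ :=
      twoRow_exchange hq hd hv hw vs as (fun bs => G (.up :: bs)) hvs
    obtain ⟨d1, d2, d3, d4⟩ :=
      twoRow_exchange hq hd hv hw vs as (fun bs => G (.down :: bs)) hvs
    obtain ⟨k1, k2⟩ := wt_exchange hq hd hx0 hv hw
    have k3 := wt_exchange' hq hd hx0 hv hw
    rw [mul_comm x v, mul_comm x w] at k1 k2 k3
    simp only [twoRow] at u1 u2 u3 u4 d1 d2 d3 d4 ⊢
    generalize sigmaHat q (q ^ 4 * (w / v)) = ρ at *
    generalize sigmaHat q (v / w) = τ at *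
    cases a <;>
      simp only [rowOp_left_up, rowOp_right_up, rowOp_left_down, rowOp_right_down, rowOp_add,
        rowOp_smul, smul_add, smul_smul] at * <;>
      generalize wtA q (v * x) = A1 at * <;>
      generalize wtA q (w * x) = A2 at * <;>
      generalize wtB q (v * x) = B1 at * <;>
      generalize wtB q (w * x) = B2 at *
    · refine ⟨?_, ?_, ?_, ?_⟩
      · linear_combination (norm := module) (B1 * B2) • u1
      · linear_combination (norm := module) B1 • d3 +
          A2 • d4 +
          (A1 * A2) • u2 +
          k1 • twoRow q v w .left .right vs as (fun bs => G (.down :: bs)) +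
          k2 • twoRow q v w .right .left vs as (fun bs => G (.down :: bs))
      · linear_combination (norm := module) B2 • d1 +
          (B2 * A1) • u3 -
          k1 • twoRow q v w .left .left vs as (fun bs => G (.down :: bs)) -
          k3 • twoRow q v w .left .right vs as (fun bs => G (.up :: bs))
      · linear_combination (norm := module) u3 +
          A1 • d1 +
          (A2 * B1) • u4 -
          k2 • twoRow q v w .left .left vs as (fun bs => G (.down :: bs)) +
          k3 • twoRow q v w .right .left vs as (fun bs => G (.up :: bs))
    · refine ⟨?_, ?_, ?_, ?_⟩
      · linear_combination (norm := module) B1 • u4 +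
          A2 • u3 +
          (A1 * A2) • d1 +
          k1 • twoRow q v w .right .left vs as (fun bs => G (.up :: bs)) +
          k2 • twoRow q v w .left .right vs as (fun bs => G (.up :: bs))
      · linear_combination (norm := module) (B1 * B2) • d2
      · linear_combination (norm := module) d4 +
          A1 • u2 +
          (A2 * B1) • d3 -
          k2 • twoRow q v w .right .right vs as (fun bs => G (.up :: bs)) +
          k3 • twoRow q v w .left .right vs as (fun bs => G (.down :: bs))
      · linear_combination (norm := module) B2 • u2 +
          (A1 * B2) • d4 -
          k1 • twoRow q v w .right .right vs as (fun bs => G (.up :: bs)) -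
          k3 • twoRow q v w .right .left vs as (fun bs => G (.down :: bs))

end Exchange

/-! ### Yang–Baxter equation for two columns -/

section Exchange

variable {K M N : Type*} [Field K] [AddCommGroup M] [Module K M] [AddCommGroup N] [Module K N]

/-- The action of an additional vertex with weights `ρ`, `τ`, `1` on two adjacent vertical edges. -/
def exchTop (ρ τ : K) (H : VDir → VDir → M) : VDir → VDir → M
  | .up, .up => ρ • H .up .up
  | .down, .down => ρ • H .down .down
  | .up, .down => H .up .down + τ • H .down .up
  | .down, .up => H .down .up + τ • H .up .down

/-- The action of `exchTop` on the entries `k` and `k + 1` of a list of vertical edges. -/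
def exchAt (ρ τ : K) : ℕ → (List VDir → M) → List VDir → M
  | 0, G, a :: b :: ds => exchTop ρ τ (fun a b => G (a :: b :: ds)) a b
  | k + 1, G, c :: cs => exchAt ρ τ k (fun bs => G (c :: bs)) cs
  -- Lists that are too short get 0, in agreement with `rowOp` and `triZ` on lists of unequal
  -- length.
  | _, _, _ => 0

theorem map_exchAt (ρ τ : K) (f : M →ₗ[K] N) : ∀ (k : ℕ) (G : List VDir → M) (as : List VDir),
    f (exchAt ρ τ k G as) = exchAt ρ τ k (fun bs => f (G bs)) as
  | 0, G, [] => by simp [exchAt]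
  | 0, G, [a] => by simp [exchAt]
  | 0, G, a :: b :: ds => by cases a <;> cases b <;> simp [exchAt, exchTop]
  | k + 1, G, [] => by simp [exchAt]
  | k + 1, G, c :: cs => map_exchAt ρ τ f k (fun bs => G (c :: bs)) cs

theorem exchAt_add (ρ τ : K) : ∀ (k : ℕ) (G H : List VDir → M) (as : List VDir),
    exchAt ρ τ k (fun bs => G bs + H bs) as = exchAt ρ τ k G as + exchAt ρ τ k H as
  | 0, G, H, [] => by simp [exchAt]
  | 0, G, H, [a] => by simp [exchAt]
  | 0, G, H, a :: b :: ds => by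
    cases a <;> cases b <;> simp only [exchAt, exchTop, smul_add] <;> abel
  | k + 1, G, H, [] => by simp [exchAt]
  | k + 1, G, H, c :: cs =>
    exchAt_add ρ τ k (fun bs => G (c :: bs)) (fun bs => H (c :: bs)) cs

theorem exchAt_smul (ρ τ c : K) (k : ℕ) (G : List VDir → M) (as : List VDir) :
    exchAt ρ τ k (fun bs => c • G bs) as = c • exchAt ρ τ k G as :=
  (map_exchAt ρ τ (c • LinearMap.id (R := K) (M := M)) k G as).symm

variable {q v w : K}

/-- The Yang–Baxter equation for two adjacent columns. -/
theorem exchAt_rowOp (hq : q ≠ 0) (hd : sigmaFn (q ^ 4) ≠ 0) (hv : v ≠ 0) (hw : w ≠ 0) {u : K}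
    (hu : u ≠ 0) (t : List K) : ∀ (p : List K) (r : HDir) (G : List VDir → M) (as : List VDir),
    exchAt (sigmaHat q (q ^ 4 * (w / v))) (sigmaHat q (v / w)) p.length
        (fun bs => rowOp q u r (p ++ v :: w :: t) bs G) as =
      rowOp q u r (p ++ w :: v :: t) as
        (exchAt (sigmaHat q (q ^ 4 * (w / v))) (sigmaHat q (v / w)) p.length G)
  | [], r, G, [] => by simp [exchAt]
  | [], r, G, [a] => by cases r <;> cases a <;> simp [exchAt]
  | [], r, G, a :: b :: ds => by
    obtain ⟨k1, k2⟩ := wt_exchange hq hd hu hv hw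
    have k3 := wt_exchange' hq hd hu hv hw
    simp only [exchAt, List.length_nil, List.nil_append]
    generalize sigmaHat q (q ^ 4 * (w / v)) = ρ at *
    generalize sigmaHat q (v / w) = τ at *
    cases r <;> cases a <;> cases b <;>
      simp only [exchTop, exchAt, rowOp_left_up, rowOp_right_up, rowOp_left_down, rowOp_right_down,
        rowOp_add, rowOp_smul, smul_add, smul_smul] at * <;>
      generalize wtA q (u * v) = A1 at * <;>
      generalize wtA q (u * w) = A2 at * <;>
      generalize wtB q (u * v) = B1 at * <;>
      generalize wtB q (u * w) = B2 at *
    all_goals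
      match_scalars <;>
        first
        | ring1
        | linear_combination k1
        | linear_combination k2
        | linear_combination -k1
        | linear_combination -k2
        | linear_combination k3
        | linear_combination -k3
  | c :: p, r, G, [] => by simp [exchAt]
  | c :: p, r, G, a :: as => by
    have ih := fun r G => exchAt_rowOp hq hd hv hw hu t p r G as
    cases r <;> cases a <;>
      simp [exchAt, exchAt_add, exchAt_smul, ih]

end Exchange

/-! ### Triangular partition function, reflection equation and symmetry -/

section Triangle

variable {K R : Type*} [Field K] [CommRing R] [Algebra K R]

/-- The partition function of the triangular six-vertex model, with line parameters `us` and edges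
`as` at the top. The left boundary weights are `kd u` if the vertex has one incoming and one
outgoing edge, and `ko u` otherwise. -/
def triZ (q : K) (kd ko : K → R) : List K → List VDir → R
  | [], [] => 1
  | u :: us, .up :: as =>
      kd u * rowOp q u .left us as (triZ q kd ko us) + ko u * rowOp q u .right us as (triZ q kd ko us)
  | u :: us, .down :: as =>
      kd u * rowOp q u .right us as (triZ q kd ko us) + ko u * rowOp q u .left us as (triZ q kd ko us)
  | _, _ => 0

variable (q : K) (kd ko : K → R) (u : K) (us : List K) (as : List VDir)

@[simp] theorem triZ_nil_nil : triZ q kd ko [] [] = 1 := rfl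

@[simp] theorem triZ_cons_nil : triZ q kd ko (u :: us) [] = 0 := rfl

@[simp] theorem triZ_nil_cons (a : VDir) : triZ q kd ko [] (a :: as) = 0 := by cases a <;> rfl

@[simp] theorem triZ_up : triZ q kd ko (u :: us) (.up :: as) =
    kd u * rowOp q u .left us as (triZ q kd ko us) +
      ko u * rowOp q u .right us as (triZ q kd ko us) := rfl

@[simp] theorem triZ_down : triZ q kd ko (u :: us) (.down :: as) =
    kd u * rowOp q u .right us as (triZ q kd ko us) +
      ko u * rowOp q u .left us as (triZ q kd ko us) := rfl

variable {q kd ko}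

/-- The reflection equation for the left boundary weights. -/
def Reflecting (q : K) (kd ko : K → R) : Prop :=
  ∀ v w : K, v ≠ 0 → w ≠ 0 →
    sigmaHat q (q ^ 4 * (w / v)) • (wtB q (v * w) • (kd v * ko w) + ko v * kd w) =
        wtB q (v * w) • (kd w * ko v) + ko w * kd v +
          (sigmaHat q (v / w) * wtA q (v * w)) • (ko w * kd v) ∧
      sigmaHat q (q ^ 4 * (w / v)) • wtA q (v * w) • (ko v * kd w) =
        sigmaHat q (v / w) • (wtB q (v * w) • (kd w * ko v) + ko w * kd v) +
          wtA q (v * w) • (ko w * kd v)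

theorem mul_rowOp (v : K) (r : HDir) (c : R) (G : List VDir → R) :
    rowOp q v r us as (fun bs => c * G bs) = c * rowOp q v r us as G :=
  (map_rowOp q v (LinearMap.mulLeft K c) r us as G).symm

theorem mul_exchAt (ρ τ : K) (k : ℕ) (c : R) (G : List VDir → R) :
    exchAt ρ τ k (fun bs => c * G bs) as = c * exchAt ρ τ k G as :=
  (map_exchAt ρ τ (LinearMap.mulLeft K c) k G as).symm

/-- The additional vertex has reached the left boundary: the reflection equation passes it across
the two boundary vertices, and `twoRow_exchange` carries it through the two rows to the right end.
Reversing all arrows preserves the weights, so the four cases form two pairs. -/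
theorem exchAt_triZ_zero (hq : q ≠ 0) (hd : sigmaFn (q ^ 4) ≠ 0) (hr : Reflecting q kd ko)
    {v w : K} (hv : v ≠ 0) (hw : w ≠ 0) {t : List K} (ht : ∀ x ∈ t, x ≠ 0) (a b : VDir)
    (ds : List VDir) :
    exchTop (sigmaHat q (q ^ 4 * (w / v))) (sigmaHat q (v / w))
        (fun a b => triZ q kd ko (v :: w :: t) (a :: b :: ds)) a b =
      sigmaHat q (q ^ 4 * (w / v)) • triZ q kd ko (w :: v :: t) (a :: b :: ds) := by
  obtain ⟨e1, e2⟩ := hr v w hv hw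
  obtain ⟨r1, r2, r3, r4⟩ := twoRow_exchange hq hd hv hw t ds (triZ q kd ko t) ht
  generalize sigmaHat q (q ^ 4 * (w / v)) = ρ at *
  generalize sigmaHat q (v / w) = τ at *
  simp only [twoRow] at r1 r2 r3 r4
  cases a <;> cases b <;>
    simp only [exchTop, triZ_up, triZ_down, rowOp_left_up, rowOp_right_up, rowOp_left_down,
      rowOp_right_down, rowOp_add, mul_rowOp, Algebra.smul_def, mul_comm w v, map_mul] at *
  · linear_combination (algebraMap K R (wtB q (v * w)) * kd v * kd w + ko v * ko w) * r1 + ko v * ko w * algebraMap K R (wtA q (v * w)) * r2 +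
      (algebraMap K R (wtB q (v * w)) * kd w * ko v + ko w * kd v) * r3 +
      algebraMap K R (wtA q (v * w)) * ko w * kd v * r4 +
      e1 * rowOp q v .left t ds (fun bs => rowOp q w .right t bs (triZ q kd ko t)) +
      e2 * rowOp q v .right t ds (fun bs => rowOp q w .left t bs (triZ q kd ko t))
  · linear_combination (kd v * kd w +
      algebraMap K R (wtB q (v * w)) * ko v * ko w) * r4 +
      algebraMap K R (wtA q (v * w)) * kd v * kd w * r3 +
      (kd w * ko v +
      algebraMap K R (wtB q (v * w)) * ko w * kd v) * r2 +
      algebraMap K R (wtA q (v * w)) * kd w * ko v * r1 -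
      e1 * rowOp q v .right t ds (fun bs => rowOp q w .right t bs (triZ q kd ko t)) -
      e2 * rowOp q v .left t ds (fun bs => rowOp q w .left t bs (triZ q kd ko t))
  · linear_combination (kd v * kd w +
      algebraMap K R (wtB q (v * w)) * ko v * ko w) * r3 +
      algebraMap K R (wtA q (v * w)) * kd v * kd w * r4 +
      (kd w * ko v +
      algebraMap K R (wtB q (v * w)) * ko w * kd v) * r1 +
      algebraMap K R (wtA q (v * w)) * kd w * ko v * r2 -
      e1 * rowOp q v .left t ds (fun bs => rowOp q w .left t bs (triZ q kd ko t)) -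
      e2 * rowOp q v .right t ds (fun bs => rowOp q w .right t bs (triZ q kd ko t))
  · linear_combination (algebraMap K R (wtB q (v * w)) * kd v * kd w + ko v * ko w) * r2 + ko v * ko w * algebraMap K R (wtA q (v * w)) * r1 +
      (algebraMap K R (wtB q (v * w)) * kd w * ko v + ko w * kd v) * r4 +
      algebraMap K R (wtA q (v * w)) * ko w * kd v * r3 +
      e1 * rowOp q v .right t ds (fun bs => rowOp q w .left t bs (triZ q kd ko t)) +
      e2 * rowOp q v .left t ds (fun bs => rowOp q w .right t bs (triZ q kd ko t))

/-- The exchange of two adjacent lines. -/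
theorem exchAt_triZ (hq : q ≠ 0) (hd : sigmaFn (q ^ 4) ≠ 0) (hr : Reflecting q kd ko)
    {v w : K} (hv : v ≠ 0) (hw : w ≠ 0) {t : List K} (ht : ∀ x ∈ t, x ≠ 0) :
    ∀ (p : List K), (∀ x ∈ p, x ≠ 0) → ∀ as : List VDir,
    exchAt (sigmaHat q (q ^ 4 * (w / v))) (sigmaHat q (v / w)) p.length
        (triZ q kd ko (p ++ v :: w :: t)) as =
      sigmaHat q (q ^ 4 * (w / v)) • triZ q kd ko (p ++ w :: v :: t) as
  | [], _, [] => by simp [exchAt]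
  | [], _, [a] => by cases a <;> simp [exchAt]
  | [], _, a :: b :: ds => exchAt_triZ_zero hq hd hr hv hw ht a b ds
  | u :: p, _, [] => by simp [exchAt]
  | u :: p, hp, a :: as => by
    obtain ⟨hu, hp⟩ : u ≠ 0 ∧ ∀ y ∈ p, y ≠ 0 := by simpa using hp
    have ih := funext (exchAt_triZ hq hd hr hv hw ht p hp)
    -- The line `u` crosses both exchanged lines above their boundary vertices, so the additional
    -- vertex is pushed down through its row.
    have hrow := fun r => exchAt_rowOp hq hd hv hw hu t p r (triZ q kd ko (p ++ v :: w :: t)) as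
    simp only [ih, rowOp_smul] at hrow
    cases a <;>
      simp only [List.length_cons, exchAt, List.cons_append, triZ_up, triZ_down, exchAt_add,
        mul_exchAt, hrow, smul_add, mul_smul_comm]

/-- The all-upward top is an eigenvector of the exchange; this turns the exchange of lines into
symmetry. -/
theorem exchAt_replicate_up {M : Type*} [AddCommGroup M] [Module K M] (ρ τ : K) (m : ℕ) :
    ∀ (k : ℕ) (G : List VDir → M),
    exchAt ρ τ k G (List.replicate (k + (m + 2)) .up) =
      ρ • G (List.replicate (k + (m + 2)) .up)
  | 0, G => by simp [exchAt, exchTop, List.replicate_succ]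
  | k + 1, G => by
    rw [show k + 1 + (m + 2) = (k + (m + 2)) + 1 by ring, List.replicate_succ, exchAt,
      exchAt_replicate_up ρ τ m k]

/-- The partition function with all edges at the top pointing upward. -/
def topZ (q : K) (kd ko : K → R) (us : List K) : R :=
  triZ q kd ko us (List.replicate us.length .up)

theorem sigmaFn_eq_zero_iff {x : K} (hx : x ≠ 0) : sigmaFn x = 0 ↔ x ^ 2 = 1 := by
  rw [sigmaFn, sub_eq_zero, ← mul_eq_one_iff_eq_inv₀ hx, sq]

theorem topZ_swap (hq : q ≠ 0) (hd : sigmaFn (q ^ 4) ≠ 0) (hd' : sigmaFn (q ^ 8) ≠ 0)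
    (hr : Reflecting q kd ko) (p t : List K) (v w : K) (h : ∀ x ∈ p ++ v :: w :: t, x ≠ 0) :
    topZ q kd ko (p ++ v :: w :: t) = topZ q kd ko (p ++ w :: v :: t) := by
  simp only [List.mem_append, List.mem_cons] at h
  have hv := h v (by simp)
  have hw := h w (by simp)
  have key : ∀ v w : K, v ≠ 0 → w ≠ 0 → sigmaHat q (q ^ 4 * (w / v)) •
      topZ q kd ko (p ++ v :: w :: t) =
        sigmaHat q (q ^ 4 * (w / v)) • topZ q kd ko (p ++ w :: v :: t) := by
    intro v w hv hw
    have := exchAt_triZ hq hd hr hv hw (t := t) (fun x hx => h x (by simp [hx])) p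
      (fun x hx => h x (by simp [hx])) (List.replicate (p.length + (t.length + 2)) .up)
    rw [exchAt_replicate_up] at this
    simpa [topZ] using this
  -- The eigenvalue must be cancelled. If it vanishes for (v, w), the one for (w, v) is used; both
  -- vanish only if q¹⁶ = 1, that is σ(q⁸) = 0.
  by_cases h1 : sigmaHat q (q ^ 4 * (w / v)) = 0
  · by_cases h2 : sigmaHat q (q ^ 4 * (v / w)) = 0
    · exfalso
      simp only [sigmaHat, div_eq_zero_iff, hd, or_false] at h1 h2
      rw [sigmaFn_eq_zero_iff (by positivity)] at h1 h2
      apply hd'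
      rw [sigmaFn_eq_zero_iff (by positivity)]
      field_simp at h1 h2
      have : v ^ 2 * ((q ^ 8) ^ 2 - 1) = 0 := by linear_combination h1 + q ^ 8 * h2
      simpa [hv, sub_eq_zero] using this
    · exact (smul_right_injective R h2 (key w v hw hv)).symm
  · exact smul_right_injective R h1 (key v w hv hw)

/-- The partition function is symmetric in the line parameters. -/
theorem topZ_perm (hq : q ≠ 0) (hd : sigmaFn (q ^ 4) ≠ 0) (hd' : sigmaFn (q ^ 8) ≠ 0)
    (hr : Reflecting q kd ko) {us vs : List K} (h : us.Perm vs) (h0 : ∀ x ∈ us, x ≠ 0) :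
    topZ q kd ko us = topZ q kd ko vs := by
  suffices H : ∀ p : List K, (∀ x ∈ p ++ us, x ≠ 0) →
      topZ q kd ko (p ++ us) = topZ q kd ko (p ++ vs) from H [] h0
  clear h0
  induction h with
  | nil => simp
  | cons x _ ih => intro p hp; simpa using ih (p ++ [x]) (by simpa using hp)
  | swap x y l => exact fun p hp => topZ_swap hq hd hd' hr p l y x hp
  | trans h1 _ ih1 ih2 =>
    intro p hp
    rw [ih1 p hp, ih2 p]
    intro x hx
    exact hp x (((List.Perm.append_left p h1).mem_iff).2 hx)

end Triangle

/-! ### Recursions at zeros of the bulk weights -/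

section Recursion

variable {K M R : Type*} [Field K] [AddCommGroup M] [Module K M] [CommRing R] [Algebra K R]
variable {q u w : K} {kd ko : K → R}

theorem rowOp_left_replicate_up : ∀ (t : List K) (G : List VDir → M),
    rowOp q u .left t (List.replicate t.length .up) G =
      (t.map fun x => wtB q (u * x)).prod • G (List.replicate t.length .up)
  | [], G => by simp
  | x :: t, G => by simp [List.replicate_succ, rowOp_left_replicate_up t, smul_smul]

/-- The edge above the last column points down and the rightmost edge points left, so the six-vertex
rule fixes the last vertex. -/
theorem rowOp_append_down : ∀ (t : List K) (as : List VDir) (r : HDir) (G : List VDir → M),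
    rowOp q u r (t ++ [w]) (as ++ [.down]) G =
      wtA q (u * w) • rowOp q u r t as (fun bs => G (bs ++ [.down]))
  | [], [], r, G => by cases r <;> simp
  | [], [a], r, G => by cases r <;> cases a <;> simp
  | [], a :: b :: as, r, G => by cases r <;> cases a <;> simp
  | [x], [], r, G => by cases r <;> simp
  | x :: y :: t, [], r, G => by cases r <;> simp
  | x :: t, a :: as, r, G => by
    cases r <;> cases a <;> simp [rowOp_append_down t as, smul_smul, mul_comm]

/-- A downward edge at the top of the last column forces the whole column, down to an off-diagonal
boundary vertex. -/
theorem triZ_append_down : ∀ (t : List K) (as : List VDir),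
    triZ q kd ko (t ++ [w]) (as ++ [.down]) =
      ko w * ((t.map fun x => wtA q (x * w)).prod • triZ q kd ko t as)
  | [], [] => by simp
  | [], a :: as => by cases a <;> cases as <;> simp
  | [x], [] => by simp
  | x :: y :: t, [] => by simp
  | x :: t, a :: as => by
    have hrow : ∀ r, rowOp q x r (t ++ [w]) (as ++ [.down]) (triZ q kd ko (t ++ [w])) =
        ko w * (((x :: t).map fun x => wtA q (x * w)).prod • rowOp q x r t as (triZ q kd ko t)) := by
      intro r
      rw [rowOp_append_down, funext (triZ_append_down t), mul_rowOp, rowOp_smul, List.map_cons,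
        List.prod_cons, mul_smul]
      simp only [mul_smul_comm]
    cases a <;> simp only [List.cons_append, triZ_up, triZ_down, hrow, mul_add,
      Algebra.smul_def] <;> ring

/-- The corner vertex at the end of the row cannot have a left-pointing edge on its left, since that
weight vanishes. The row therefore points right up to the corner, where both horizontal edges enter.
-/
theorem rowOp_replicate_up_append (h : wtB q (u * w) = 0) : ∀ (t : List K) (G : List VDir → M),
    rowOp q u .left (t ++ [w]) (List.replicate (t.length + 1) .up) G = 0 ∧
    rowOp q u .right (t ++ [w]) (List.replicate (t.length + 1) .up) G =
      (t.map fun x => wtA q (u * x)).prod • G (List.replicate t.length .up ++ [.down])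
  | [], G => by simp [h]
  | x :: t, G => by
    have ih := rowOp_replicate_up_append h t
    simp only [List.replicate_succ (n := t.length)] at ih
    simp [List.replicate_succ, ih, smul_smul]

/-- The first row of the partition function. -/
theorem topZ_cons (x : K) (t : List K) : topZ q kd ko (x :: t) =
    kd x * ((t.map fun y => wtB q (x * y)).prod • topZ q kd ko t) +
      ko x * rowOp q x .right t (List.replicate t.length .up) (triZ q kd ko t) := by
  simp [topZ, List.replicate_succ, rowOp_left_replicate_up]

/-- The recursion at a zero of the weight `σ̂(q²/(uw))`. -/
theorem topZ_cons_append (h : wtB q (u * w) = 0) (t : List K) :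
    topZ q kd ko (u :: (t ++ [w])) =
      ko u * ko w * ((t.map fun x => wtA q (u * x) * wtA q (x * w)).prod • topZ q kd ko t) := by
  simp only [topZ, List.length_cons, List.length_append, List.length_nil, List.replicate_succ,
    triZ_up, zero_add]
  have := fun G : List VDir → R => rowOp_replicate_up_append h t G
  simp only [List.replicate_succ (n := t.length)] at this
  simp only [(this _).1, (this _).2]
  rw [triZ_append_down, List.prod_map_mul]
  simp only [Algebra.smul_def, map_mul]
  ring

/-- The recursion at a zero of the weight `σ̂(q²uw)`. -/
theorem topZ_cons_cons (h : wtA q (u * w) = 0)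
    (hk : ko u * kd w + wtB q (u * w) • (kd u * ko w) = 0) (t : List K) :
    topZ q kd ko (u :: w :: t) = (ko u * ko w + wtB q (u * w) • (kd u * kd w)) *
      ((t.map fun x => wtB q (u * x) * wtB q (w * x)).prod • topZ q kd ko t) := by
  have hup : triZ q kd ko (w :: t) (List.replicate (t.length + 1) .up) =
    topZ q kd ko (w :: t) := rfl
  rw [topZ_cons, topZ_cons, List.length_cons, List.replicate_succ, rowOp_right_up,
    rowOp_left_replicate_up, h, zero_smul, add_zero, triZ_down, rowOp_left_replicate_up,
    List.prod_map_mul, List.map_cons, List.prod_cons]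
  simp only [Algebra.smul_def, map_mul, topZ] at *
  -- The terms in which the second row enters rightwards cancel by `hk`; in the others both rows run
  -- left under upward edges.
  linear_combination (algebraMap K R (t.map fun x => wtB q (u * x)).prod *
    rowOp q w .right t (List.replicate t.length .up) (triZ q kd ko t)) * hk

end Recursion

/-! ### Laurent polynomials of fixed parity and interpolation -/

section Laurent

open Polynomial

variable {K M : Type*} [Field K]

/-- The function `f` is a Laurent polynomial of degree at most `n` and order at least `-n`, all
of whose exponents have the parity of `n`. -/
def IsLaurent (n : ℕ) (f : K → K) : Prop :=
  ∃ P : K[X], P.natDegree ≤ n ∧ ∀ x, x ≠ 0 → x ^ n * f x = P.eval (x ^ 2)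

theorem IsLaurent.const (c : K) : IsLaurent 0 fun _ => c := ⟨C c, by simp, by simp⟩

theorem IsLaurent.linear (a b : K) : IsLaurent 1 fun x => a * x + b * x⁻¹ := by
  refine ⟨C a * X + C b, natDegree_linear_le, fun x hx => ?_⟩
  simp only [eval_add, eval_mul, eval_C, eval_X]
  field_simp

theorem IsLaurent.congr {n : ℕ} {f g : K → K} (hf : IsLaurent n f)
    (h : ∀ x, x ≠ 0 → g x = f x) : IsLaurent n g := by
  obtain ⟨P, hP, hf⟩ := hf
  exact ⟨P, hP, fun x hx => by rw [h x hx, hf x hx]⟩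

theorem IsLaurent.add {n : ℕ} {f g : K → K} (hf : IsLaurent n f) (hg : IsLaurent n g) :
    IsLaurent n fun x => f x + g x := by
  obtain ⟨P, hP, hf⟩ := hf
  obtain ⟨Q, hQ, hg⟩ := hg
  exact ⟨P + Q, (natDegree_add_le _ _).trans (max_le hP hQ),
    fun x hx => by rw [mul_add, hf x hx, hg x hx, eval_add]⟩

theorem IsLaurent.mul {m n k : ℕ} {f g : K → K} (hf : IsLaurent m f) (hg : IsLaurent n g)
    (h : m + n = k) : IsLaurent k fun x => f x * g x := by
  obtain ⟨P, hP, hf⟩ := hf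
  obtain ⟨Q, hQ, hg⟩ := hg
  refine ⟨P * Q, natDegree_mul_le.trans ((add_le_add hP hQ).trans h.le), fun x hx => ?_⟩
  rw [eval_mul, ← hf x hx, ← hg x hx, ← h]
  ring

theorem IsLaurent.const_mul {n : ℕ} {f : K → K} (c : K) (hf : IsLaurent n f) :
    IsLaurent n fun x => c * f x := (IsLaurent.const c).mul hf (zero_add n)

/-- Inverting the variable reverses the coefficients of the polynomial in x². -/
theorem IsLaurent.comp_inv {n : ℕ} {f : K → K} (hf : IsLaurent n f) :
    IsLaurent n fun x => f x⁻¹ := by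
  obtain ⟨P, hP, hf⟩ := hf
  refine ⟨P.reflect n, (natDegree_reflect_le).trans (max_le le_rfl hP), fun x hx => ?_⟩
  have h := hf x⁻¹ (inv_ne_zero hx)
  let _ : Invertible (x⁻¹ ^ 2) := invertibleOfNonzero (by positivity)
  have h2 := eval₂_reflect_mul_pow (RingHom.id K) (x⁻¹ ^ 2) n P hP
  rw [invOf_eq_inv] at h2
  simp only [eval₂_id, inv_pow, inv_inv] at h2 h
  rw [← h] at h2
  field_simp at h2
  rw [one_div] at h2
  exact mul_left_cancel₀ (pow_ne_zero n hx) (by linear_combination -h2)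

/-- Two Laurent polynomials that agree at sufficiently many points are equal. -/
theorem IsLaurent.ext {n : ℕ} {f g : K → K} (hf : IsLaurent n f) (hg : IsLaurent n g)
    {ns : List K} (hn : n < ns.length) (hns : (ns.map (· ^ 2)).Nodup) (h0 : ∀ x ∈ ns, x ≠ 0)
    (h : ∀ x ∈ ns, f x = g x) {x : K} (hx : x ≠ 0) : f x = g x := by
  classical
  obtain ⟨P, hP, hf⟩ := hf
  obtain ⟨Q, hQ, hg⟩ := hg
  -- Both are polynomials of degree at most n in x², so the squares of the nodes must be distinct
  -- and n + 1 nodes suffice.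
  have hPQ : P = Q := by
    refine eq_of_degree_sub_lt_of_eval_finset_eq (ns.map (· ^ 2)).toFinset ?_ ?_
    · rw [List.toFinset_card_of_nodup hns, List.length_map]
      refine lt_of_le_of_lt (degree_le_of_natDegree_le ?_) (Nat.cast_lt.2 hn)
      exact (natDegree_sub_le _ _).trans (max_le hP hQ)
    · simp only [List.mem_toFinset, List.mem_map]
      rintro _ ⟨y, hy, rfl⟩
      rw [← hf y (h0 y hy), ← hg y (h0 y hy), h y hy]
  exact mul_left_cancel₀ (pow_ne_zero n hx) (by rw [hf x hx, hg x hx, hPQ])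

variable {q : K}

theorem isLaurent_sigmaFn (a : K) : IsLaurent 1 fun x => sigmaFn (a * x) := by
  refine (IsLaurent.linear a (-a⁻¹)).congr fun x _ => ?_
  rw [sigmaFn, mul_inv]
  ring

theorem isLaurent_wtA (y : K) : IsLaurent 1 fun x => wtA q (x * y) := by
  refine ((isLaurent_sigmaFn (q ^ 2 * y)).const_mul (sigmaFn (q ^ 4))⁻¹).congr fun x _ => ?_
  rw [wtA, sigmaHat, div_eq_inv_mul]
  ring_nf

theorem isLaurent_wtB (y : K) : IsLaurent 1 fun x => wtB q (x * y) := by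
  refine ((isLaurent_sigmaFn (q ^ 2 * y⁻¹)).comp_inv.const_mul
    (sigmaFn (q ^ 4))⁻¹).congr fun x _ => ?_
  rw [wtB, sigmaHat, div_eq_inv_mul, mul_inv]
  ring_nf

theorem isLaurent_prod_wtB : ∀ t : List K,
    IsLaurent t.length fun x => (t.map fun y => wtB q (x * y)).prod
  | [] => by simpa using IsLaurent.const 1
  | y :: t => by
    simpa using (isLaurent_wtB y).mul (isLaurent_prod_wtB t) (add_comm 1 t.length)

/-- A row entering rightwards under upward edges turns exactly once, at a vertex of weight 1. Hence
the degree is one less than the number of vertices, which leaves enough interpolation nodes. -/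
theorem isLaurent_rowOp : ∀ (y : K) (t : List K) (G : List VDir → K),
    IsLaurent t.length fun x =>
      rowOp q x .right (y :: t) (List.replicate (t.length + 1) .up) G
  | y, [], G => by simpa using IsLaurent.const _
  | y, z :: t, G => by
    simp only [List.replicate_succ (n := (z :: t).length), rowOp_right_up, rowOp_left_replicate_up,
      smul_eq_mul]
    refine .add ?_ ((isLaurent_wtA y).mul (isLaurent_rowOp z t fun bs => G (.up :: bs))
      (add_comm 1 t.length))
    simpa only [mul_comm] using
      (isLaurent_prod_wtB (z :: t)).const_mul (G (.down :: List.replicate (z :: t).length .up))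

end Laurent

/-! ### The off-diagonal model and the model with indeterminate diagonal weight -/

section Models

open Polynomial

variable {K : Type*} [Field K] {q : K}

/-- The off-diagonal left boundary weight `σ(qu)/σ(q)`. -/
def wtO (q u : K) : K := sigmaFn (q * u) / sigmaFn q

/-- The partition function of off-diagonally symmetric alternating sign matrices. -/
def offZ (q : K) (us : List K) : K := topZ q (fun _ => (0 : K)) (fun _ => 1) us

/-- The partition function in which the diagonal left boundary weights are an indeterminate. -/
noncomputable def polyZ (q : K) (us : List K) : K[X] :=
  topZ q (fun _ => (X : K[X])) (fun u => C (wtO q u)) us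

/-- The linear coefficient of `polyZ`. -/
noncomputable def linZ (q : K) (us : List K) : K := (polyZ q us).coeff 1

theorem reflecting_off : Reflecting q (fun _ => (0 : K)) (fun _ => 1) := by
  intro v w _ _
  simp

theorem reflecting_poly (hq : q ≠ 0) (hd : sigmaFn (q ^ 4) ≠ 0) (hs : sigmaFn q ≠ 0) :
    Reflecting q (fun _ => (X : K[X])) (fun u => C (wtO q u)) := by
  intro v w hv hw
  have h1 : sigmaHat q (q ^ 4 * (w / v)) * (wtB q (v * w) * wtO q w + wtO q v) =
      wtB q (v * w) * wtO q v + wtO q w + sigmaHat q (v / w) * wtA q (v * w) * wtO q w := by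
    simp only [wtA, wtB, sigmaHat, wtO]
    field_simp
    simp only [sigmaFn]
    field_simp
    ring
  have h2 : sigmaHat q (q ^ 4 * (w / v)) * (wtA q (v * w) * wtO q v) =
      sigmaHat q (v / w) * (wtB q (v * w) * wtO q v + wtO q w) + wtA q (v * w) * wtO q w := by
    simp only [wtA, wtB, sigmaHat, wtO]
    field_simp
    simp only [sigmaFn]
    field_simp
    ring
  have e1 := congrArg C h1
  have e2 := congrArg C h2
  simp only [smul_eq_C_mul, map_mul, map_add] at e1 e2 ⊢
  exact ⟨by linear_combination X * e1, by linear_combination X * e2⟩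

/-- At X = 0 every boundary vertex is off-diagonal, and its weight depends only on its line, so it
factors out. -/
theorem coeff_zero_triZ : ∀ (us : List K) (as : List VDir),
    (triZ q (fun _ => (X : K[X])) (fun u => C (wtO q u)) us as).coeff 0 =
      (us.map (wtO q)).prod * triZ q (fun _ => (0 : K)) (fun _ => 1) us as
  | [], [] => by simp
  | [], a :: as => by simp
  | u :: us, [] => by simp
  | u :: us, a :: as => by
    have h := fun r => map_rowOp q u (lcoeff K 0) r us as
      (triZ q (fun _ => (X : K[X])) (fun u => C (wtO q u)) us)
    simp only [lcoeff_apply, coeff_zero_triZ us, mul_rowOp] at h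
    cases a <;> simp [h, mul_assoc]

theorem coeff_zero_polyZ (us : List K) :
    (polyZ q us).coeff 0 = (us.map (wtO q)).prod * offZ q us := coeff_zero_triZ _ _

theorem isLaurent_offZ (y : K) (t : List K) :
    IsLaurent t.length fun x => offZ q (x :: y :: t) := by
  simpa only [offZ, topZ_cons, zero_mul, zero_add, one_mul, List.length_cons] using isLaurent_rowOp y t _

/-- In the first summand the first line already supplies the factor X, so only the constant
coefficient of the remaining lines enters. -/
theorem linZ_cons (x : K) (t : List K) : linZ q (x :: t) =
    (t.map fun y => wtB q (x * y)).prod * ((t.map (wtO q)).prod * offZ q t) +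
      wtO q x * rowOp q x .right t (List.replicate t.length .up)
        (fun bs => (triZ q (fun _ => (X : K[X])) (fun u => C (wtO q u)) t bs).coeff 1) := by
  rw [linZ, polyZ, topZ_cons, coeff_add, coeff_X_mul, coeff_C_mul, coeff_smul, smul_eq_mul]
  congr 2
  · exact coeff_zero_polyZ t ▸ rfl
  · exact map_rowOp q x (lcoeff K 1) _ _ _ _

theorem isLaurent_linZ (y : K) (t : List K) :
    IsLaurent (t.length + 1) fun x => linZ q (x :: y :: t) := by
  simp only [linZ_cons]
  refine .add ?_ (IsLaurent.mul (m := 1) ?_ (isLaurent_rowOp y t _) (add_comm _ _))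
  · simpa only [mul_comm, List.length_cons] using (isLaurent_prod_wtB (y :: t)).const_mul _
  · exact ((isLaurent_sigmaFn q).const_mul (sigmaFn q)⁻¹).congr fun x _ => div_eq_inv_mul _ _

end Models

/-! ### The point q² + q̄² = 1 and the recursions for both models -/

section Combinatorial

open Polynomial

variable {K : Type*} [Field K] {q : K}

theorem sigmaFn_neg (x : K) : sigmaFn (-x) = -sigmaFn x := by
  rw [sigmaFn, sigmaFn, inv_neg]; ring

theorem sigmaFn_inv (x : K) : sigmaFn x⁻¹ = -sigmaFn x := by
  rw [sigmaFn, sigmaFn, inv_inv]; ring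

theorem sigmaFn_one : sigmaFn (1 : K) = 0 := by simp [sigmaFn]

theorem ne_zero_of_sixth (hq : q ^ 2 + q⁻¹ ^ 2 = 1) : q ≠ 0 := by
  rintro rfl
  simp at hq

theorem pow_four_of_sixth (hq : q ^ 2 + q⁻¹ ^ 2 = 1) : q ^ 4 = q ^ 2 - 1 := by
  have h0 := ne_zero_of_sixth hq
  field_simp at hq
  linear_combination hq

theorem pow_six_of_sixth (hq : q ^ 2 + q⁻¹ ^ 2 = 1) : q ^ 6 = -1 := by
  linear_combination (q ^ 2 + 1) * pow_four_of_sixth hq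

theorem sigmaFn_sq_of_sixth (hq : q ^ 2 + q⁻¹ ^ 2 = 1) : sigmaFn q ^ 2 = -1 := by
  have h0 := ne_zero_of_sixth hq
  rw [sigmaFn]
  linear_combination hq - 2 * mul_inv_cancel₀ h0

theorem sigmaFn_pow_four_sq_of_sixth (hq : q ^ 2 + q⁻¹ ^ 2 = 1) : sigmaFn (q ^ 4) ^ 2 = -3 := by
  have h0 := ne_zero_of_sixth hq
  have h6 := pow_six_of_sixth hq
  have h4 := pow_four_of_sixth hq
  have : (q ^ 4)⁻¹ = -q ^ 2 :=
    inv_eq_of_mul_eq_one_right (by linear_combination -h6)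
  rw [sigmaFn, this]
  linear_combination (q ^ 4 + 3 * q ^ 2) * h4 + 3 * h4

theorem offZ_recursion_wtA {u w : K} {t : List K} (h : wtA q (u * w) = 0) :
    offZ q (u :: w :: t) = (t.map fun x => wtB q (u * x) * wtB q (w * x)).prod * offZ q t := by
  rw [offZ, topZ_cons_cons h (by simp)]
  simp [offZ]

theorem nodup_map_div_sq {c : K} (hc : c ≠ 0) {t : List K} (h : (t.map (· ^ 2)).Nodup) :
    ((t.map (c / ·)).map (· ^ 2)).Nodup := by
  have : (t.map (c / ·)).map (· ^ 2) = (t.map (· ^ 2)).map (c ^ 2 / ·) := by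
    simp [Function.comp_def, div_pow]
  rw [this]
  refine h.map fun x y hxy => ?_
  simpa [div_eq_mul_inv, hc] using hxy

theorem wtB_eq_zero_of_mul_eq {x w : K} (hq : q ≠ 0) (h : x * w = q ^ 2) :
    wtB q (x * w) = 0 := by
  rw [wtB, h, sigmaHat, mul_inv_cancel₀ (by positivity), sigmaFn_one, zero_div]

theorem wtA_inv (x : K) : wtA q x⁻¹ = wtB q x := rfl

theorem wtB_inv (x : K) : wtB q x⁻¹ = wtA q x := by rw [wtB, inv_inv, wtA]

theorem offZ_singleton (x : K) : offZ q [x] = 0 := by simp [offZ, topZ, List.replicate_succ]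

variable [CharZero K]

theorem sigmaFn_ne_zero_of_sixth (hq : q ^ 2 + q⁻¹ ^ 2 = 1) : sigmaFn q ≠ 0 := by
  intro h
  have := sigmaFn_sq_of_sixth hq
  simp [h] at this

theorem sigmaFn_pow_four_ne_zero_of_sixth (hq : q ^ 2 + q⁻¹ ^ 2 = 1) : sigmaFn (q ^ 4) ≠ 0 := by
  intro h
  have := sigmaFn_pow_four_sq_of_sixth hq
  simp [h] at this

theorem sigmaFn_pow_eight_ne_zero_of_sixth (hq : q ^ 2 + q⁻¹ ^ 2 = 1) :
    sigmaFn (q ^ 8) ≠ 0 := by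
  have h0 := ne_zero_of_sixth hq
  have h4 := pow_four_of_sixth hq
  have h6 := pow_six_of_sixth hq
  rw [Ne, sigmaFn_eq_zero_iff (by positivity)]
  intro h
  have h2 : q ^ 2 = 2 := by linear_combination h - (q ^ 10 - q ^ 4) * h6 - h4
  have h3 : (3 : K) = 0 := by linear_combination h4 - (q ^ 2 + 1) * h2
  norm_num at h3

theorem offZ_perm (hq : q ^ 2 + q⁻¹ ^ 2 = 1) {us vs : List K} (h : us.Perm vs)
    (h0 : ∀ x ∈ us, x ≠ 0) : offZ q us = offZ q vs :=
  topZ_perm (ne_zero_of_sixth hq) (sigmaFn_pow_four_ne_zero_of_sixth hq)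
    (sigmaFn_pow_eight_ne_zero_of_sixth hq) reflecting_off h h0

theorem polyZ_perm (hq : q ^ 2 + q⁻¹ ^ 2 = 1) {us vs : List K} (h : us.Perm vs)
    (h0 : ∀ x ∈ us, x ≠ 0) : polyZ q us = polyZ q vs :=
  topZ_perm (ne_zero_of_sixth hq) (sigmaFn_pow_four_ne_zero_of_sixth hq)
    (sigmaFn_pow_eight_ne_zero_of_sixth hq)
    (reflecting_poly (ne_zero_of_sixth hq) (sigmaFn_pow_four_ne_zero_of_sixth hq)
      (sigmaFn_ne_zero_of_sixth hq)) h h0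

theorem linZ_perm (hq : q ^ 2 + q⁻¹ ^ 2 = 1) {us vs : List K} (h : us.Perm vs)
    (h0 : ∀ x ∈ us, x ≠ 0) : linZ q us = linZ q vs := by
  rw [linZ, linZ, polyZ_perm hq h h0]

/-- Symmetry moves `w` to the end, which puts the vertex of vanishing weight in the corner of the
first row. -/
theorem offZ_recursion_wtB (hq : q ^ 2 + q⁻¹ ^ 2 = 1) {u w : K} {t : List K}
    (h0 : ∀ x ∈ u :: w :: t, x ≠ 0) (h : wtB q (u * w) = 0) :
    offZ q (u :: w :: t) = (t.map fun x => wtA q (u * x) * wtA q (w * x)).prod * offZ q t := by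
  have hp : (u :: w :: t).Perm (u :: (t ++ [w])) :=
    List.Perm.cons u (List.perm_append_singleton w t).symm
  rw [offZ_perm hq hp h0, offZ, topZ_cons_append h]
  simp [offZ, mul_comm _ w]

theorem linZ_recursion_wtB (hq : q ^ 2 + q⁻¹ ^ 2 = 1) {u w : K} {t : List K}
    (h0 : ∀ x ∈ u :: w :: t, x ≠ 0) (h : wtB q (u * w) = 0) :
    linZ q (u :: w :: t) = wtO q u * wtO q w *
      ((t.map fun x => wtA q (u * x) * wtA q (w * x)).prod * linZ q t) := by
  have hp : (u :: w :: t).Perm (u :: (t ++ [w])) :=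
    List.Perm.cons u (List.perm_append_singleton w t).symm
  rw [linZ_perm hq hp h0, linZ, polyZ, topZ_cons_append h, ← C_mul, coeff_C_mul, coeff_smul,
    smul_eq_mul]
  simp [linZ, polyZ, mul_comm _ w]

/-- Here uw = ±q̄², so σ̂(q²/(uw)) = ±1 while the boundary weights at u and w agree up to the
opposite sign; this is the cancellation required by `topZ_cons_cons`. The term with two diagonal
boundary vertices carries X² and does not reach the linear coefficient. -/
theorem linZ_recursion_wtA (hq : q ^ 2 + q⁻¹ ^ 2 = 1) {u w : K} {t : List K} (hu : u ≠ 0)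
    (hw : w ≠ 0) (h : wtA q (u * w) = 0) :
    linZ q (u :: w :: t) = wtO q u * wtO q w *
      ((t.map fun x => wtB q (u * x) * wtB q (w * x)).prod * linZ q t) := by
  have h0 := ne_zero_of_sixth hq
  have hs := sigmaFn_pow_four_ne_zero_of_sixth hq
  have hk : wtO q u + wtB q (u * w) * wtO q w = 0 := by
    rw [wtA, sigmaHat, div_eq_zero_iff, or_iff_left hs, sigmaFn_eq_zero_iff (by positivity), sq,
      mul_self_eq_one_iff] at h
    rcases h with h | h
    · have h1 : q ^ 2 * (u * w)⁻¹ = q ^ 4 := by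
        field_simp
        linear_combination -h
      have h2 : q * w = (q * u)⁻¹ := by
        field_simp
        linear_combination h
      rw [wtB, h1, sigmaHat, div_self hs, wtO, wtO, h2, sigmaFn_inv]
      ring
    · have h1 : q ^ 2 * (u * w)⁻¹ = -q ^ 4 := by
        field_simp
        linear_combination h
      have h2 : q * w = -(q * u)⁻¹ := by
        field_simp
        linear_combination h
      rw [wtB, h1, sigmaHat, sigmaFn_neg, neg_div, div_self hs, wtO, wtO, h2, sigmaFn_neg,
        sigmaFn_inv]
      ring
  rw [linZ, polyZ, topZ_cons_cons h]
  · simp only [add_mul, coeff_add, ← C_mul, coeff_C_mul, coeff_smul, smul_eq_mul, smul_mul_assoc,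
      mul_assoc, coeff_X_mul, coeff_X_mul_zero]
    simp [linZ, polyZ]
  · simp only [smul_eq_C_mul]
    have := congrArg C hk
    simp only [map_add, map_mul, map_zero] at this
    linear_combination X * this

end Combinatorial

/-! ### Interpolation for the off-diagonal model -/

section Combinatorial

open Polynomial

variable {K : Type*} [Field K] {q : K}

/-- Two families of Laurent polynomials agree if they agree when the first variable `x` satisfies
`xw = q²` for one of the remaining variables `w`. -/
theorem eq_of_eq_at_nodes (hq : q ≠ 0) {f g : K → K} {t : List K} {n : ℕ}
    (hf : IsLaurent n f) (hg : IsLaurent n g) (hn : n < t.length) (h0 : ∀ x ∈ t, x ≠ 0)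
    (ht : (t.map (· ^ 2)).Nodup)
    (h : ∀ x w r, x ≠ 0 → x * w = q ^ 2 → t.Perm (w :: r) → f x = g x) {x : K} (hx : x ≠ 0) :
    f x = g x := by
  classical
  have hq2 : q ^ 2 ≠ 0 := pow_ne_zero 2 hq
  refine hf.ext hg (ns := t.map (q ^ 2 / ·)) (by simpa using hn) (nodup_map_div_sq hq2 ht) ?_ ?_ hx
  · simp only [List.mem_map]
    rintro _ ⟨w, hw, rfl⟩
    exact div_ne_zero hq2 (h0 w hw)
  · simp only [List.mem_map]
    rintro _ ⟨w, hw, rfl⟩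
    exact h _ w (t.erase w) (div_ne_zero hq2 (h0 w hw)) (div_mul_cancel₀ _ (h0 w hw))
      (List.perm_cons_erase hw)

variable [CharZero K]

/-- A single line vanishes because its off-diagonal boundary vertex would send the last edge right.
The recursion lowers the order by two at every node. -/
theorem offZ_eq_zero_of_odd (hq : q ^ 2 + q⁻¹ ^ 2 = 1) (m : ℕ) : ∀ us : List K,
    us.length = 2 * m + 1 → (∀ x ∈ us, x ≠ 0) → (us.map (· ^ 2)).Nodup → offZ q us = 0 := by
  have hq0 := ne_zero_of_sixth hq
  induction m with
  | zero =>
    intro us hl _ _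
    obtain ⟨x, rfl⟩ := List.length_eq_one_iff.1 hl
    exact offZ_singleton x
  | succ m ih =>
    intro us hl h0 hd
    match us, hl with
    | x :: y :: t, hl =>
      have ht0 : ∀ z ∈ y :: t, z ≠ 0 := fun z hz => h0 z (List.mem_cons_of_mem x hz)
      have hdt : ((y :: t).map (· ^ 2)).Nodup := (List.nodup_cons.1 hd).2
      refine eq_of_eq_at_nodes (f := fun x => offZ q (x :: y :: t)) (g := fun _ => 0) hq0
        (isLaurent_offZ y t) ⟨0, by simp, by simp⟩ (by simp) ht0 hdt ?_ (h0 x (by simp))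
      intro x w r hx hxw hp
      have hp' : (x :: y :: t).Perm (x :: w :: r) := hp.cons x
      have hwr : ∀ z ∈ x :: w :: r, z ≠ 0 := by
        intro z hz
        rcases List.mem_cons.1 hz with rfl | hz
        · exact hx
        · exact ht0 z (hp.mem_iff.2 hz)
      have hdr : ((w :: r).map (· ^ 2)).Nodup := (hp.map _).nodup_iff.1 hdt
      have hlr := hp.length_eq
      simp only [List.length_cons] at hlr hl
      rw [← offZ_perm hq hp'.symm hwr, offZ_recursion_wtB hq hwr (wtB_eq_zero_of_mul_eq hq0 hxw),
        ih r (by omega) (fun z hz => hwr z (by simp [hz])) (List.nodup_cons.1 hdr).2, mul_zero]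

/-- Inversion interchanges the two bulk weights, so the recursions at a zero of one and at a zero of
the other have equal factors. -/
theorem offZ_map_inv (hq : q ^ 2 + q⁻¹ ^ 2 = 1) (m : ℕ) : ∀ us : List K,
    us.length = 2 * m → (∀ x ∈ us, x ≠ 0) → (us.map (· ^ 2)).Nodup →
    offZ q (us.map (·⁻¹)) = offZ q us := by
  have hq0 := ne_zero_of_sixth hq
  induction m with
  | zero =>
    intro us hl _ _
    rw [List.length_eq_zero_iff.1 hl, List.map_nil]
  | succ m ih =>
    intro us hl h0 hd
    match us, hl with
    | x :: y :: t, hl =>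
      have ht0 : ∀ z ∈ y :: t, z ≠ 0 := fun z hz => h0 z (List.mem_cons_of_mem x hz)
      have hdt : ((y :: t).map (· ^ 2)).Nodup := (List.nodup_cons.1 hd).2
      have hlau := (isLaurent_offZ (q := q) y⁻¹ (t.map (·⁻¹))).comp_inv
      rw [List.length_map] at hlau
      refine eq_of_eq_at_nodes (f := fun x => offZ q ((x :: y :: t).map (·⁻¹))) hq0
        hlau (isLaurent_offZ y t) (by simp) ht0 hdt ?_ (h0 x (by simp))
      intro x w r hx hxw hp
      have hp' : (x :: y :: t).Perm (x :: w :: r) := hp.cons x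
      have hwr : ∀ z ∈ x :: w :: r, z ≠ 0 := by
        intro z hz
        rcases List.mem_cons.1 hz with rfl | hz
        · exact hx
        · exact ht0 z (hp.mem_iff.2 hz)
      have hwr' : ∀ z ∈ (x :: w :: r).map (·⁻¹), z ≠ 0 := by
        simp only [List.mem_map]
        rintro _ ⟨z, hz, rfl⟩
        exact inv_ne_zero (hwr z hz)
      have hdr : ((w :: r).map (· ^ 2)).Nodup := (hp.map _).nodup_iff.1 hdt
      have hlr := hp.length_eq
      simp only [List.length_cons] at hlr hl
      have hB := wtB_eq_zero_of_mul_eq hq0 hxw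
      rw [← offZ_perm hq hp'.symm hwr, offZ_recursion_wtB hq hwr hB,
        ← offZ_perm hq (hp'.map (·⁻¹)).symm hwr', List.map_cons, List.map_cons,
        offZ_recursion_wtA (by rw [← mul_inv, wtA_inv, hB]),
        ih r (by omega) (fun z hz => hwr z (by simp [hz])) (List.nodup_cons.1 hdr).2, List.map_map]
      simp only [Function.comp_def, ← mul_inv, wtB_inv]

end Combinatorial

/-! ### The symmetrised linear coefficient and its recursion -/

section Main

open Polynomial

variable {K : Type*} [Field K] {q I : K}

theorem inv_of_sq_eq_neg_one (hI : I ^ 2 = -1) : I⁻¹ = -I :=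
  inv_eq_of_mul_eq_one_right (by linear_combination -hI)

theorem sigmaFn_pow_three_mul (hq : q ^ 2 + q⁻¹ ^ 2 = 1) (z : K) :
    sigmaFn (q ^ 3 * z) = q ^ 3 * (z + z⁻¹) := by
  have h : (q ^ 3)⁻¹ = -q ^ 3 :=
    inv_eq_of_mul_eq_one_right (by linear_combination -pow_six_of_sixth hq)
  rw [sigmaFn, mul_inv, h]
  ring

/-- This is why i is the additional parameter: its bulk weights reproduce the factors σ(q/z) of
`linSum`. -/
theorem wtA_mul_I (hq : q ^ 2 + q⁻¹ ^ 2 = 1) (hI : I ^ 2 = -1) (z : K) :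
    wtA q (z * I) = -(I * q ^ 3 * sigmaFn (q * z⁻¹)) / sigmaFn (q ^ 4) := by
  have h0 := ne_zero_of_sixth hq
  have h : (q ^ 2)⁻¹ = -q ^ 4 :=
    inv_eq_of_mul_eq_one_right (by linear_combination -pow_six_of_sixth hq)
  have e : sigmaFn (q ^ 2 * (z * I)) = -(I * q ^ 3 * sigmaFn (q * z⁻¹)) := by
    rw [sigmaFn, sigmaFn, mul_inv, mul_inv, mul_inv, h, inv_of_sq_eq_neg_one hI, inv_inv]
    linear_combination -I * q ^ 2 * z * mul_inv_cancel₀ h0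
  rw [wtA, sigmaHat, e]

variable [CharZero K]

/-- The sum of `Z(u)` and `Z(1/u)`, where `Z` is the linear coefficient of the partition function
without its denominators. -/
noncomputable def linSum (q : K) (us : List K) : K :=
  (us.map fun u => sigmaFn (q * u⁻¹)).prod * linZ q us +
    (us.map fun u => sigmaFn (q * u)).prod * linZ q (us.map (·⁻¹))

/-- The off-diagonal partition function with an additional line parameter `I`. -/
def offExt (q I : K) (us : List K) : K := (us.map fun u => u + u⁻¹).prod * offZ q (I :: us)

theorem linSum_perm (hq : q ^ 2 + q⁻¹ ^ 2 = 1) {us vs : List K} (h : us.Perm vs)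
    (h0 : ∀ x ∈ us, x ≠ 0) : linSum q us = linSum q vs := by
  have h0' : ∀ x ∈ us.map (·⁻¹), x ≠ 0 := by
    simp only [List.mem_map]
    rintro _ ⟨z, hz, rfl⟩
    exact inv_ne_zero (h0 z hz)
  rw [linSum, linSum, linZ_perm hq h h0, linZ_perm hq (h.map _) h0', (h.map _).prod_eq,
    (h.map fun u => sigmaFn (q * u)).prod_eq]

theorem offExt_perm (hq : q ^ 2 + q⁻¹ ^ 2 = 1) (hI : I ≠ 0) {us vs : List K} (h : us.Perm vs)
    (h0 : ∀ x ∈ us, x ≠ 0) : offExt q I us = offExt q I vs := by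
  rw [offExt, offExt, (h.map _).prod_eq, offZ_perm hq (h.cons I) (by simpa [hI] using h0)]

/-- Both summands acquire the same factor: `linZ` drops two parameters at xw = q² and, for the
inverses, at x̄w̄ = q̄². The sign is σ(q)⁻² = -1. -/
theorem linSum_recursion (hq : q ^ 2 + q⁻¹ ^ 2 = 1) {x w : K} {r : List K}
    (h0 : ∀ z ∈ x :: w :: r, z ≠ 0) (hxw : x * w = q ^ 2) :
    linSum q (x :: w :: r) =
      -(sigmaFn (q * x⁻¹) * sigmaFn (q * w⁻¹) * sigmaFn (q * x) * sigmaFn (q * w)) *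
        ((r.map fun z => wtA q (x * z) * wtA q (w * z)).prod * linSum q r) := by
  have hB := wtB_eq_zero_of_mul_eq (ne_zero_of_sixth hq) hxw
  have hx := h0 x (by simp)
  have hw := h0 w (by simp)
  have hs := sigmaFn_ne_zero_of_sixth hq
  have hs2 : (sigmaFn q)⁻¹ ^ 2 = -1 := by rw [inv_pow, sigmaFn_sq_of_sixth hq]; norm_num
  rw [linSum, linZ_recursion_wtB hq h0 hB, List.map_cons (f := (·⁻¹)), List.map_cons (f := (·⁻¹)),
    linZ_recursion_wtA hq (inv_ne_zero hx) (inv_ne_zero hw) (by rw [← mul_inv, wtA_inv, hB]),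
    List.map_map, linSum]
  simp only [Function.comp_def, ← mul_inv, wtB_inv, List.map_cons, List.prod_cons, wtO,
    div_eq_mul_inv]
  generalize (r.map fun z => wtA q (x * z) * wtA q (w * z)).prod = p
  linear_combination (sigmaFn (q * x⁻¹) * sigmaFn (q * w⁻¹) * sigmaFn (q * x) * sigmaFn (q * w)) *
    p * ((r.map fun u => sigmaFn (q * u⁻¹)).prod * linZ q r +
    (r.map fun u => sigmaFn (q * u)).prod * linZ q (r.map (·⁻¹))) * hs2

/-- At xw = q² the factors x+x̄ and w+w̄ are σ(qw) and σ(qx) up to q³, and the bulk weights with i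
give the other two σ's. The 3 comes from σ(q⁴)² = -3, so the ratio to `linSum_recursion` is -3. -/
theorem offExt_recursion (hq : q ^ 2 + q⁻¹ ^ 2 = 1) (hI : I ^ 2 = -1) {x w : K} {r : List K}
    (h0 : ∀ z ∈ x :: w :: r, z ≠ 0) (hxw : x * w = q ^ 2) :
    3 * offExt q I (x :: w :: r) =
      (sigmaFn (q * x⁻¹) * sigmaFn (q * w⁻¹) * sigmaFn (q * x) * sigmaFn (q * w)) *
        ((r.map fun z => wtA q (x * z) * wtA q (w * z)).prod * offExt q I r) := by
  have hq0 := ne_zero_of_sixth hq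
  have hB := wtB_eq_zero_of_mul_eq hq0 hxw
  have hx := h0 x (by simp)
  have hw := h0 w (by simp)
  have hI0 : I ≠ 0 := by rintro rfl; simp at hI
  have hd := sigmaFn_pow_four_ne_zero_of_sixth hq
  have hd2 : 3 * (sigmaFn (q ^ 4))⁻¹ ^ 2 = -1 := by
    rw [inv_pow, sigmaFn_pow_four_sq_of_sixth hq]; norm_num
  have hp : (I :: x :: w :: r).Perm (x :: w :: I :: r) := by
    refine (List.Perm.swap x I _).trans (List.Perm.cons x (List.Perm.swap w I _))
  have hw' : q * w = q ^ 3 * x⁻¹ := by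
    field_simp
    linear_combination hxw
  have hx' : q * x = -(q ^ 3 * w)⁻¹ := by
    field_simp
    linear_combination pow_six_of_sixth hq + q ^ 4 * hxw
  have e1 : sigmaFn (q * w) = q ^ 3 * (x + x⁻¹) := by
    rw [hw', sigmaFn_pow_three_mul hq, inv_inv, add_comm]
  have e2 : sigmaFn (q * x) = q ^ 3 * (w + w⁻¹) := by
    rw [hx', sigmaFn_neg, sigmaFn_inv, neg_neg, sigmaFn_pow_three_mul hq]
  rw [offExt, offZ_perm hq hp (by simpa [hI0] using h0),
    offZ_recursion_wtB hq (by simpa [hI0, and_left_comm] using h0) hB, offExt]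
  simp only [List.map_cons, List.prod_cons, wtA_mul_I hq hI, e1, e2, div_eq_mul_inv]
  generalize (r.map fun z => wtA q (x * z) * wtA q (w * z)).prod = p
  linear_combination (x + x⁻¹) * (w + w⁻¹) * (r.map fun u => u + u⁻¹).prod * p * offZ q (I :: r) *
    sigmaFn (q * x⁻¹) * sigmaFn (q * w⁻¹) * q ^ 6 * (I ^ 2 * hd2 - hI)

/-- Compares, one parameter at a time, what remains of the two sides of `linSum_eq` at the node q̄;
the constant per parameter has square -3. -/
theorem prod_wt_I (hq : q ^ 2 + q⁻¹ ^ 2 = 1) (hI : I ^ 2 = -1) : ∀ s : List K,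
    (s.map fun z => sigmaFn (q * z⁻¹)).prod *
        ((s.map fun z => wtB q (q⁻¹ * z)).prod * (s.map (wtO q)).prod) =
      (I * sigmaFn (q ^ 4) * (sigmaFn q)⁻¹) ^ s.length *
        ((s.map fun z => z + z⁻¹).prod *
          (s.map fun z => wtA q (q⁻¹ * z) * wtA q (I * z)).prod)
  | [] => by simp
  | z :: s => by
    have ih := prod_wt_I hq hI s
    have hq0 := ne_zero_of_sixth hq
    have hd := sigmaFn_pow_four_ne_zero_of_sixth hq
    have hz : sigmaFn (q * z⁻¹) * (wtB q (q⁻¹ * z) * wtO q z) =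
        (I * sigmaFn (q ^ 4) * (sigmaFn q)⁻¹) * ((z + z⁻¹) * (wtA q (q⁻¹ * z) * wtA q (I * z))) := by
      have e1 : q ^ 2 * (q⁻¹ * z)⁻¹ = q ^ 3 * z⁻¹ := by
        rw [mul_inv, inv_inv]; ring
      have e2 : q ^ 2 * (q⁻¹ * z) = q * z := by
        field_simp
      rw [mul_comm I z, wtA_mul_I hq hI, wtB, e1, sigmaHat, sigmaFn_pow_three_mul hq, inv_inv, wtA,
        e2, sigmaHat, wtO]
      simp only [div_eq_mul_inv]
      linear_combination q ^ 3 * sigmaFn (q * z⁻¹) * sigmaFn (q * z) * (z + z⁻¹) *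
        (sigmaFn q)⁻¹ * (sigmaFn (q ^ 4))⁻¹ *
        (sigmaFn (q ^ 4) * (sigmaFn (q ^ 4))⁻¹ * hI - mul_inv_cancel₀ hd)
    simp only [List.map_cons, List.prod_cons, List.length_cons, pow_succ _ s.length]
    linear_combination (sigmaFn (q * z⁻¹) * (wtB q (q⁻¹ * z) * wtO q z)) * ih +
      (I * sigmaFn (q ^ 4) * (sigmaFn q)⁻¹) ^ s.length * ((s.map fun z => z + z⁻¹).prod *
        (s.map fun z => wtA q (q⁻¹ * z) * wtA q (I * z)).prod) * hz

end Main

/-! ### The identity between linear coefficient and off-diagonal model -/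

section Main

open Polynomial

variable {K : Type*} [Field K] {q I : K}

theorem linZ_inv_q_cons (hq : q ^ 2 + q⁻¹ ^ 2 = 1) (s : List K) : linZ q (q⁻¹ :: s) =
    (s.map fun z => wtB q (q⁻¹ * z)).prod * ((s.map (wtO q)).prod * offZ q s) := by
  rw [linZ_cons, wtO, mul_inv_cancel₀ (ne_zero_of_sixth hq), sigmaFn_one, zero_div, zero_mul,
    add_zero]

theorem linSum_map_inv (us : List K) : linSum q (us.map (·⁻¹)) = linSum q us := by
  simp [linSum, Function.comp_def, add_comm]

theorem linZ_singleton (x : K) : linZ q [x] = 1 := by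
  simp [linZ_cons, offZ, topZ]

theorem offExt_singleton (x : K) : offExt q I [x] = x + x⁻¹ := by
  simp [offExt, offZ, topZ, List.replicate_succ]

theorem isLaurent_linSum (y : K) (t : List K) :
    IsLaurent (t.length + 2) fun x => linSum q (x :: y :: t) := by
  have h1 := isLaurent_linZ (q := q) y t
  have h2 := (isLaurent_linZ (q := q) y⁻¹ (t.map (·⁻¹))).comp_inv
  rw [List.length_map] at h2
  have h4 := (isLaurent_sigmaFn q).mul h2 (by ring : _ = t.length + 2)
  have h3 := (isLaurent_sigmaFn q).comp_inv.mul h1 (by ring : _ = t.length + 2)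
  refine ((h3.const_mul ((y :: t).map fun u => sigmaFn (q * u⁻¹)).prod).add
    (h4.const_mul ((y :: t).map fun u => sigmaFn (q * u)).prod)).congr fun x _ => ?_
  simp only [linSum, List.map_cons, List.prod_cons]
  ring

variable [CharZero K]

/-- The second summand contains σ(qq̄) = 0, and in the first the boundary weight at q̄ vanishes. On
the other side σ̂(q²/(iq̄)) = 0, so `offZ` drops both i and q̄. -/
theorem linSum_inv_q_cons (hq : q ^ 2 + q⁻¹ ^ 2 = 1) (hI : I ^ 2 = -1) {s : List K} {m : ℕ}
    (hs : s.length = 2 * m) (h0 : ∀ x ∈ s, x ≠ 0) :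
    linSum q (q⁻¹ :: s) = (-3) ^ m * sigmaFn q * offExt q I (q⁻¹ :: s) := by
  have hq0 := ne_zero_of_sixth hq
  have hI0 : I ≠ 0 := by rintro rfl; simp at hI
  have hk : (I * sigmaFn (q ^ 4) * (sigmaFn q)⁻¹) ^ 2 = -3 := by
    rw [mul_pow, mul_pow, hI, sigmaFn_pow_four_sq_of_sixth hq, inv_pow, sigmaFn_sq_of_sixth hq]
    norm_num
  have h := prod_wt_I hq hI s
  rw [hs, pow_mul, hk] at h
  have hB : wtB q (I * q⁻¹) = 0 := by
    have : q ^ 2 * (I * q⁻¹)⁻¹ = q ^ 3 * I⁻¹ := by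
      rw [mul_inv, inv_inv]; ring
    rw [wtB, this, sigmaHat, sigmaFn_pow_three_mul hq, inv_inv, inv_of_sq_eq_neg_one hI]
    simp
  have hqq : sigmaFn (q * q) = sigmaFn q * (q⁻¹ + q) := by
    rw [sigmaFn, sigmaFn, mul_inv]; ring
  rw [linSum, offExt, offZ_recursion_wtB hq (by simpa [hI0, hq0] using h0) hB,
    linZ_inv_q_cons hq]
  simp only [List.map_cons, List.prod_cons, inv_inv, mul_inv_cancel₀ hq0, sigmaFn_one, hqq,
    mul_comm (wtA q (I * _))]
  linear_combination sigmaFn q * (q⁻¹ + q) * offZ q s * h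

/-- The parameter i is inverted together with the others, so its square -1 must differ from theirs
for `offZ_map_inv` to apply. -/
theorem offExt_map_inv (hq : q ^ 2 + q⁻¹ ^ 2 = 1) (hI : I ^ 2 = -1) {us : List K} {m : ℕ}
    (hl : us.length = 2 * m + 1) (h0 : ∀ x ∈ us, x ≠ 0) (hd : (us.map (· ^ 2)).Nodup)
    (h1 : ∀ x ∈ us, x ^ 2 ≠ -1) : offExt q I⁻¹ (us.map (·⁻¹)) = offExt q I us := by
  have hI0 : I ≠ 0 := by rintro rfl; simp at hI
  have h := offZ_map_inv hq (m + 1) (I :: us) (by simp [hl]; ring) (by simpa [hI0] using h0)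
    (by simpa [hI, hd] using h1)
  rw [List.map_cons] at h
  simp [offExt, Function.comp_def, h, add_comm]

theorem isLaurent_offExt (hq : q ^ 2 + q⁻¹ ^ 2 = 1) (hI : I ≠ 0) {y : K} {t : List K}
    (h0 : ∀ x ∈ y :: t, x ≠ 0) :
    IsLaurent (t.length + 2) fun x => offExt q I (x :: y :: t) := by
  refine ((((IsLaurent.linear 1 1).mul (isLaurent_offZ (q := q) I (y :: t))
    (by simp; ring : _ = t.length + 2))).const_mul
      ((y :: t).map fun u => u + u⁻¹).prod).congr fun x hx => ?_
  rw [offExt, offZ_perm hq (List.Perm.swap x I _) (by simpa [hI, hx] using h0)]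
  simp only [List.map_cons, List.prod_cons]
  ring

/-- The linear coefficient of the partition function of odd order and the off-diagonal partition
function of even order. -/
theorem linSum_eq (hq : q ^ 2 + q⁻¹ ^ 2 = 1) (hI : I ^ 2 = -1) (m : ℕ) : ∀ us : List K,
    us.length = 2 * m + 1 → (∀ x ∈ us, x ≠ 0) → (us.map (· ^ 2)).Nodup →
    (∀ x ∈ us, x ^ 2 ≠ -1) → (∀ x ∈ us, x ^ 2 ≠ q ^ 2) →
    linSum q us = (-3) ^ m * sigmaFn q * offExt q I us := by
  have hq0 := ne_zero_of_sixth hq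
  have h4 := pow_four_of_sixth hq
  have h6 := pow_six_of_sixth hq
  have hI0 : I ≠ 0 := by rintro rfl; simp at hI
  induction m with
  | zero =>
    intro us hl _ _ _ _
    obtain ⟨x, rfl⟩ := List.length_eq_one_iff.1 hl
    simp only [linSum, List.map_cons, List.map_nil, List.prod_cons, List.prod_nil, linZ_singleton,
      offExt_singleton, sigmaFn, mul_inv, inv_inv]
    ring
  | succ m ih =>
    intro us hl h0 hd h1 h2
    match us, hl with
    | x :: y :: t, hl =>
      have ht0 : ∀ z ∈ y :: t, z ≠ 0 := fun z hz => h0 z (List.mem_cons_of_mem x hz)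
      have ht1 : ∀ z ∈ y :: t, z ^ 2 ≠ -1 := fun z hz => h1 z (List.mem_cons_of_mem x hz)
      have ht2 : ∀ z ∈ y :: t, z ^ 2 ≠ q ^ 2 := fun z hz => h2 z (List.mem_cons_of_mem x hz)
      have hdt : ((y :: t).map (· ^ 2)).Nodup := (List.nodup_cons.1 hd).2
      have hlt : (y :: t).length = 2 * (m + 1) := by simp at hl ⊢; omega
      have hq1 : q ^ 2 ≠ -1 := fun h => by
        have : (3 : K) = 0 := by linear_combination h4 - (q ^ 2 - 2) * h
        norm_num at this
      have hq2 : q ^ 2 ≠ q⁻¹ ^ 2 := fun h => by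
        have : 2 * q ^ 2 = 1 := by linear_combination h + hq
        have : (3 : K) = 0 := by linear_combination 4 * h4 - (2 * q ^ 2 - 1) * this
        norm_num at this
      -- The degree is `t.length + 2`, but the points q²/w number only `t.length + 1`; q and q̄
      -- supply the two missing nodes.
      refine (isLaurent_linSum y t).ext (ns := q :: q⁻¹ :: (y :: t).map (q ^ 2 / ·))
        ((isLaurent_offExt hq hI0 ht0).const_mul ((-3) ^ (m + 1) * sigmaFn q))
        (by simp) ?_ ?_ ?_ (h0 x (by simp))
      -- Coincidences would mean q² = q̄², w² = q² (for q), or w² = q⁶ = -1 (for q̄).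
      · rw [List.map_cons, List.map_cons, List.nodup_cons, List.nodup_cons]
        refine ⟨?_, ?_, nodup_map_div_sq (pow_ne_zero 2 hq0) hdt⟩
        · rw [List.mem_cons, not_or]
          refine ⟨hq2, ?_⟩
          simp only [List.mem_map, not_exists, not_and]
          rintro _ ⟨w, hw, rfl⟩ h
          have hw0 := ht0 w hw
          field_simp at h
          exact ht2 w hw h.symm
        · simp only [List.mem_map, not_exists, not_and]
          rintro _ ⟨w, hw, rfl⟩ h
          have hw0 := ht0 w hw
          field_simp at h
          exact ht1 w hw (by linear_combination -h + h6)
      · simp only [List.mem_cons (a := _) (b := q), List.mem_cons (b := q⁻¹), List.mem_map]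
        rintro z (rfl | rfl | ⟨w, hw, rfl⟩)
        · exact hq0
        · exact inv_ne_zero hq0
        · exact div_ne_zero (pow_ne_zero 2 hq0) (ht0 w hw)
      · simp only [List.mem_cons (a := _) (b := q), List.mem_cons (b := q⁻¹), List.mem_map]
        rintro z (hz | hz | ⟨w, hw, rfl⟩)
        -- The node q reduces to q̄ by inverting all parameters, with i replaced by its inverse,
        -- another square root of -1.
        · rw [hz]
          have hI' : I⁻¹ ^ 2 = -1 := by rw [inv_pow, hI]; norm_num
          have ht0' : ∀ z ∈ (y :: t).map (·⁻¹), z ≠ 0 := by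
            simp only [List.mem_map]
            rintro _ ⟨z, hz, rfl⟩
            exact inv_ne_zero (ht0 z hz)
          rw [← linSum_map_inv, List.map_cons (f := (·⁻¹)),
            linSum_inv_q_cons hq hI' (by rw [List.length_map, hlt]) ht0',
            ← List.map_cons (f := (·⁻¹)), offExt_map_inv hq hI (m := m + 1)]
          · rw [List.length_cons, hlt]
          · exact List.forall_mem_cons.2 ⟨hq0, ht0⟩
          · rw [List.map_cons, List.nodup_cons]
            refine ⟨?_, hdt⟩
            simp only [List.mem_map, not_exists, not_and]
            exact ht2
          · exact List.forall_mem_cons.2 ⟨hq1, ht1⟩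
        · rw [hz]
          exact linSum_inv_q_cons hq hI hlt ht0
        · classical
          have hw0 := ht0 w hw
          have hx0 : q ^ 2 / w ≠ 0 := div_ne_zero (pow_ne_zero 2 hq0) hw0
          have hp : (y :: t).Perm (w :: (y :: t).erase w) := List.perm_cons_erase hw
          generalize (y :: t).erase w = r at hp
          have hr : ∀ z ∈ r, z ∈ y :: t := fun z hz => hp.mem_iff.2 (List.mem_cons_of_mem w hz)
          have hdr : ((w :: r).map (· ^ 2)).Nodup := (hp.map _).nodup_iff.1 hdt
          have hlr : r.length = 2 * m + 1 := by
            have := hp.length_eq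
            rw [hlt, List.length_cons] at this
            omega
          have h0' : ∀ z ∈ q ^ 2 / w :: y :: t, z ≠ 0 := List.forall_mem_cons.2 ⟨hx0, ht0⟩
          have h0'' : ∀ z ∈ q ^ 2 / w :: w :: r, z ≠ 0 :=
            List.forall_mem_cons.2 ⟨hx0, List.forall_mem_cons.2 ⟨hw0, fun z hz => ht0 z (hr z hz)⟩⟩
          have hxw : q ^ 2 / w * w = q ^ 2 := div_mul_cancel₀ _ hw0
          rw [linSum_perm hq (hp.cons _) h0', offExt_perm hq hI0 (hp.cons _) h0',
            linSum_recursion hq h0'' hxw, ih r hlr (fun z hz => ht0 z (hr z hz))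
              (List.nodup_cons.1 hdr).2 (fun z hz => ht1 z (hr z hz))
              (fun z hz => ht2 z (hr z hz))]
          linear_combination (-3) ^ m * sigmaFn q * offExt_recursion hq hI h0'' hxw

end Main

/-! ### One row of configurations as a transfer operator -/

section Configurations

theorem VDir.sum_univ {M : Type*} [AddCommMonoid M] (f : VDir → M) :
    ∑ a, f a = f .up + f .down := by
  rw [show (Finset.univ : Finset VDir) = {.up, .down} from rfl, Finset.sum_pair (by decide)]

theorem HDir.sum_univ {M : Type*} [AddCommMonoid M] (f : HDir → M) :
    ∑ a, f a = f .left + f .right := by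
  rw [show (Finset.univ : Finset HDir) = {.left, .right} from rfl, Finset.sum_pair (by decide)]

theorem sum_fin_cons_arrow {α M : Type*} [Fintype α] [AddCommMonoid M] {n : ℕ}
    (f : (Fin (n + 1) → α) → M) :
    ∑ x, f x = ∑ a, ∑ y : Fin n → α, f (Fin.cons a y) := by
  rw [← Fintype.sum_prod_type', ← (Fin.consEquiv fun _ : Fin (n + 1) => α).sum_comp]
  rfl

variable {K : Type*} [Field K] {q : K}

/-- One row of the six-vertex model as a sum over the orientations of its edges. -/
theorem sum_row_eq_rowOp (u : K) : ∀ (n : ℕ) (r : HDir) (v : Fin n → K) (a : Fin n → VDir)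
    (G : List VDir → K),
    ∑ b : Fin n → VDir, ∑ h : Fin n → HDir,
      (if (Fin.cons r h : Fin (n + 1) → HDir) (Fin.last n) = .left then
        (∏ j, bulkWeight q (a j) (b j) ((Fin.cons r h : Fin (n + 1) → HDir) j.castSucc) (h j)
          (u * v j)) * G (List.ofFn b) else 0) =
      rowOp q u r (List.ofFn v) (List.ofFn a) G
  | 0, r, v, a, G => by cases r <;> simp
  | n + 1, r, v, a, G => by
    have ih := fun b₀ h₀ => sum_row_eq_rowOp u n h₀ (fun j => v j.succ) (fun j => a j.succ)
      (fun bs => G (b₀ :: bs))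
    have step : ∀ b₀ h₀, ∑ b : Fin n → VDir, ∑ h : Fin n → HDir,
        (if (Fin.cons r (Fin.cons h₀ h) : Fin (n + 2) → HDir) (Fin.last (n + 1)) = .left then
        (∏ j, bulkWeight q (a j) ((Fin.cons b₀ b : Fin (n + 1) → VDir) j)
          ((Fin.cons r (Fin.cons h₀ h) : Fin (n + 2) → HDir) j.castSucc)
          ((Fin.cons h₀ h : Fin (n + 1) → HDir) j) (u * v j)) *
            G (List.ofFn (Fin.cons b₀ b : Fin (n + 1) → VDir)) else 0) =
        bulkWeight q (a 0) b₀ r h₀ (u * v 0) *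
          rowOp q u h₀ (List.ofFn fun j => v j.succ) (List.ofFn fun j => a j.succ)
            (fun bs => G (b₀ :: bs)) := by
      intro b₀ h₀
      rw [← ih, Finset.mul_sum]
      refine Finset.sum_congr rfl fun b _ => ?_
      rw [Finset.mul_sum]
      refine Finset.sum_congr rfl fun h _ => ?_
      rw [Fin.prod_univ_succ, List.ofFn_cons, ← Fin.succ_last]
      simp only [Fin.cons_succ, Fin.cons_zero, Fin.castSucc_zero, ← Fin.succ_castSucc, mul_ite,
        mul_zero, mul_assoc]
    have key : ∀ f : (Fin (n + 1) → VDir) → (Fin (n + 1) → HDir) → K, ∑ b, ∑ h, f b h =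
        ∑ b₀, ∑ h₀, ∑ b : Fin n → VDir, ∑ h : Fin n → HDir, f (Fin.cons b₀ b) (Fin.cons h₀ h) := by
      intro f
      rw [sum_fin_cons_arrow]
      refine Finset.sum_congr rfl fun b₀ _ => ?_
      simp only [sum_fin_cons_arrow (α := HDir)]
      exact Finset.sum_comm
    rw [key]
    simp only [step]
    simp only [VDir.sum_univ, HDir.sum_univ, List.ofFn_succ (f := v), List.ofFn_succ (f := a)]
    generalize a 0 = a₀
    cases r <;> cases a₀ <;> simp [bulkWeight, wtA, wtB, add_comm]

end Configurations

/-! ### Removing the first row of a configuration -/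

section Configurations

variable {n : ℕ}

/-- The vertices of `T_{n+1}` are those of its first row and those of a copy of `T_n`. -/
noncomputable def vertexEquiv (n : ℕ) : Fin (n + 1) ⊕ TVertex n ≃ TVertex (n + 1) :=
  Equiv.ofBijective
    (Sum.elim (fun j => ⟨(0, j), Fin.zero_le j⟩)
      (fun p => ⟨(p.1.1.succ, p.1.2.succ), Fin.succ_le_succ_iff.2 p.2⟩)) (by
    constructor
    · rintro (j | ⟨⟨i, j⟩, h⟩) (j' | ⟨⟨i', j'⟩, h'⟩) he <;>
        simp_all [Subtype.ext_iff, Prod.ext_iff, Fin.succ_ne_zero, (Fin.succ_ne_zero _).symm]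
    · rintro ⟨⟨i, j⟩, h⟩
      induction i using Fin.cases with
      | zero => exact ⟨.inl j, rfl⟩
      | succ i =>
        induction j using Fin.cases with
        | zero => exact absurd h (by simp)
        | succ j => exact ⟨.inr ⟨(i, j), Fin.succ_le_succ_iff.1 h⟩, rfl⟩)

/-- Splitting a function on the vertices of `T_{n+1}` into the first row and the rest. -/
noncomputable def splitEquiv (n : ℕ) (α : Type*) :
    (TVertex (n + 1) → α) ≃ (Fin (n + 1) → α) × (TVertex n → α) :=
  ((vertexEquiv n).arrowCongr (Equiv.refl α)).symm.trans (Equiv.sumArrowEquivProdArrow _ _ _)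

/-- The configuration on `T_n` obtained by deleting the first row. -/
def EdgeOrientation.tail (C : EdgeOrientation (n + 1)) : EdgeOrientation n :=
  (fun p => C.1 ⟨(p.1.1.succ, p.1.2.succ), Fin.succ_le_succ_iff.2 p.2⟩,
    fun p => C.2 ⟨(p.1.1.succ, p.1.2.succ), Fin.succ_le_succ_iff.2 p.2⟩)

theorem sum_edgeOrientation_succ {M : Type*} [AddCommMonoid M]
    (f : (Fin (n + 1) → VDir) → (Fin (n + 1) → HDir) → EdgeOrientation n → M) :
    ∑ C : EdgeOrientation (n + 1),
      f (fun j => C.1 ⟨(0, j), Fin.zero_le j⟩) (fun j => C.2 ⟨(0, j), Fin.zero_le j⟩) C.tail =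
      ∑ a, ∑ h, ∑ C, f a h C := by
  let e : EdgeOrientation (n + 1) ≃
      (Fin (n + 1) → VDir) × (Fin (n + 1) → HDir) × EdgeOrientation n :=
    ((splitEquiv n VDir).prodCongr (splitEquiv n HDir)).trans
      ((Equiv.prodProdProdComm _ _ _ _).trans (Equiv.prodAssoc _ _ _))
  rw [← Fintype.sum_prod_type', ← Fintype.sum_prod_type', ← (Equiv.prodAssoc _ _ _).symm.sum_comp,
    ← e.sum_comp]
  rfl

variable {K : Type*} [Field K] {q : K}

/-- The weight of a configuration. -/
def confWeight (q : K) (l : VDir → HDir → K → K) (u : Fin n → K) (C : EdgeOrientation n) : K :=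
  (∏ i : Fin n, l (C.above i i le_rfl) (C.rightOf i i le_rfl) (u i)) *
    ∏ i : Fin n, ∏ j : Fin n,
      if h : i < j then
        bulkWeight q (C.above i j h.le) (C.below i j h) (C.leftOf i j h) (C.rightOf i j h.le)
          (u i * u j)
      else 1

/-- The edges at the top of a configuration. -/
def EdgeOrientation.top : ∀ {n : ℕ}, EdgeOrientation n → Fin n → VDir
  | _ + 1, C, j => C.1 ⟨(0, j), Fin.zero_le j⟩

/-- All edges at the right boundary point left. -/
def EdgeOrientation.RightLeft (C : EdgeOrientation n) : Prop :=
  ∀ (i j : Fin n) (h : i ≤ j), j.1 + 1 = n → C.rightOf i j h = HDir.left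

theorem EdgeOrientation.rightLeft_succ (C : EdgeOrientation (n + 1)) :
    C.RightLeft ↔ C.2 ⟨(0, Fin.last n), Fin.zero_le _⟩ = .left ∧ C.tail.RightLeft := by
  constructor
  · intro h
    exact ⟨h 0 (Fin.last n) (Fin.zero_le _) rfl,
      fun i j hij hj => h i.succ j.succ (Fin.succ_le_succ_iff.2 hij) (by simpa using hj)⟩
  · rintro ⟨h0, h⟩ i j hij hj
    induction i using Fin.cases with
    | zero =>
      obtain rfl : j = Fin.last n := Fin.ext (by simpa using hj)
      exact h0
    | succ i =>
      induction j using Fin.cases with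
      | zero => exact absurd hij (by simp)
      | succ j => exact h i j (Fin.succ_le_succ_iff.1 hij) (by simpa using hj)

theorem confWeight_succ (l : VDir → HDir → K → K) (u : Fin (n + 1) → K)
    (C : EdgeOrientation (n + 1)) :
    confWeight q l u C =
      l (C.1 ⟨(0, 0), le_rfl⟩) (C.2 ⟨(0, 0), le_rfl⟩) (u 0) *
        (∏ j : Fin n, bulkWeight q (C.1 ⟨(0, j.succ), Fin.zero_le _⟩) (C.tail.top j)
          (C.2 ⟨(0, j.castSucc), Fin.zero_le _⟩) (C.2 ⟨(0, j.succ), Fin.zero_le _⟩)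
          (u 0 * u j.succ)) * confWeight q l (fun i => u i.succ) C.tail := by
  have h1 : ∀ j : Fin n, C.below 0 j.succ (Fin.succ_pos j) = C.tail.top j := by
    intro j
    obtain _ | n := n
    · exact j.elim0
    · rfl
  have h2 : ∀ (i j : Fin n) (h : i < j), C.below i.succ j.succ (Fin.succ_lt_succ_iff.2 h) =
      C.tail.below i j h := fun i j h => rfl
  have h3 : ∀ (i j : Fin n) (h : i < j), C.leftOf i.succ j.succ (Fin.succ_lt_succ_iff.2 h) =
      C.tail.leftOf i j h := by
    intro i j h
    obtain ⟨j, hj⟩ := j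
    obtain _ | j := j
    · exact absurd h (by simp [Fin.lt_def])
    · rfl
  have h4 : ∀ j : Fin n, C.leftOf 0 j.succ (Fin.succ_pos j) =
      C.2 ⟨(0, j.castSucc), Fin.zero_le _⟩ := fun j => rfl
  simp only [confWeight, Fin.prod_univ_succ, Fin.succ_lt_succ_iff, dite_false,
    Fin.succ_pos, dite_true, Fin.not_lt_zero, one_mul, h1, h4]
  rw [mul_mul_mul_comm]
  refine congrArg₂ _ rfl (congrArg₂ _ rfl ?_)
  refine Finset.prod_congr rfl fun i _ => Finset.prod_congr rfl fun j _ => ?_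
  split_ifs with h
  · rw [h2 i j h, h3 i j h]
    rfl
  · rfl

end Configurations

/-! ### From configuration sums to `topZ` -/

section Configurations

variable {K : Type*} [Field K] {q : K}

open Classical in
/-- The partition function as a sum over all edge orientations with given top edges. -/
theorem sum_confWeight_eq_triZ {l : VDir → HDir → K → K} {kd ko : K → K}
    (h1 : l .up .left = kd) (h2 : l .down .right = kd) (h3 : l .up .right = ko)
    (h4 : l .down .left = ko) : ∀ (n : ℕ) (u : Fin n → K) (a : Fin n → VDir),
    ∑ C : EdgeOrientation n, (if C.top = a ∧ C.RightLeft then confWeight q l u C else 0) =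
      triZ q kd ko (List.ofFn u) (List.ofFn a)
  | 0, u, a => by
    have hC : ∀ C : EdgeOrientation 0, C.top = a ∧ C.RightLeft :=
      fun C => ⟨funext fun j => j.elim0, fun i => i.elim0⟩
    simp [hC, confWeight]
  | n + 1, u, a => by
    have ih := sum_confWeight_eq_triZ h1 h2 h3 h4 n (fun i => u i.succ)
    let F : (Fin (n + 1) → VDir) → (Fin (n + 1) → HDir) → EdgeOrientation n → K := fun a' h C' =>
      if a' = a ∧ h (Fin.last n) = .left ∧ C'.RightLeft then
        l (a' 0) (h 0) (u 0) * (∏ j : Fin n, bulkWeight q (a' j.succ) (C'.top j)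
          (h j.castSucc) (h j.succ) (u 0 * u j.succ)) * confWeight q l (fun i => u i.succ) C'
      else 0
    have e1 : ∀ C : EdgeOrientation (n + 1),
        (if C.top = a ∧ C.RightLeft then confWeight q l u C else 0) =
        F (fun j => C.1 ⟨(0, j), Fin.zero_le j⟩) (fun j => C.2 ⟨(0, j), Fin.zero_le j⟩) C.tail := by
      intro C
      rw [confWeight_succ]
      exact if_congr (and_congr Iff.rfl C.rightLeft_succ) rfl rfl
    -- The edges between the first row and the rest become an independent summation variable `b`, so
    -- that the induction hypothesis and the row sum separate.
    have e2 : ∀ h : Fin (n + 1) → HDir, ∑ C' : EdgeOrientation n,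
        (if h (Fin.last n) = .left ∧ C'.RightLeft then
            l (a 0) (h 0) (u 0) * (∏ j : Fin n, bulkWeight q (a j.succ) (C'.top j)
              (h j.castSucc) (h j.succ) (u 0 * u j.succ)) * confWeight q l (fun i => u i.succ) C'
          else 0) = ∑ b : Fin n → VDir, if h (Fin.last n) = .left then
            l (a 0) (h 0) (u 0) * ((∏ j : Fin n, bulkWeight q (a j.succ) (b j)
              (h j.castSucc) (h j.succ) (u 0 * u j.succ)) *
                triZ q kd ko (List.ofFn fun i => u i.succ) (List.ofFn b)) else 0 := by
      intro h
      simp only [← ih, Finset.mul_sum]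
      by_cases hl : h (Fin.last n) = .left
      · simp only [hl, true_and, if_true]
        rw [Finset.sum_comm]
        refine Finset.sum_congr rfl fun C' _ => ?_
        rw [Finset.sum_eq_single C'.top]
        · simp only [true_and, mul_ite, mul_zero, mul_assoc]
        · intro b _ hb
          rw [if_neg fun h => hb h.1.symm, mul_zero, mul_zero]
        · simp
      · simp [hl]
    rw [Finset.sum_congr rfl fun C _ => e1 C, sum_edgeOrientation_succ F, Finset.sum_eq_single a]
    · simp only [F, true_and]
      rw [Finset.sum_congr rfl fun h _ => e2 h, sum_fin_cons_arrow]
      have e3 : ∀ r : HDir, ∑ h : Fin n → HDir, ∑ b : Fin n → VDir,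
          (if (Fin.cons r h : Fin (n + 1) → HDir) (Fin.last n) = .left then
            l (a 0) ((Fin.cons r h : Fin (n + 1) → HDir) 0) (u 0) *
              ((∏ j : Fin n, bulkWeight q (a j.succ) (b j)
                ((Fin.cons r h : Fin (n + 1) → HDir) j.castSucc)
                ((Fin.cons r h : Fin (n + 1) → HDir) j.succ) (u 0 * u j.succ)) *
                  triZ q kd ko (List.ofFn fun i => u i.succ) (List.ofFn b)) else 0) =
          l (a 0) r (u 0) * rowOp q (u 0) r (List.ofFn fun i => u i.succ)
            (List.ofFn fun i => a i.succ) (triZ q kd ko (List.ofFn fun i => u i.succ)) := by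
        intro r
        rw [← sum_row_eq_rowOp, Finset.sum_comm, Finset.mul_sum]
        refine Finset.sum_congr rfl fun b _ => ?_
        rw [Finset.mul_sum]
        refine Finset.sum_congr rfl fun h _ => ?_
        simp only [Fin.cons_zero, Fin.cons_succ, mul_ite, mul_zero]
      simp only [e3, HDir.sum_univ, List.ofFn_succ (f := u), List.ofFn_succ (f := a)]
      generalize a 0 = a₀
      cases a₀ <;> simp [h1, h2, h3, h4, add_comm]
    · intro b _ hb
      simp [F, hb]
    · simp

theorem bulkWeight_eq_zero {a b : VDir} {l r : HDir} (h : incomingCount a b l r ≠ 2) (x : K) :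
    bulkWeight q a b l r x = 0 := by
  cases a <;> cases b <;> cases l <;> cases r <;> first | rfl | exact absurd rfl h

/-- Bulk weights vanish where the six-vertex rule fails, so the sum may run over all orientations.
Equal α and β make the two diagonal boundary weights equal. -/
theorem dsasmZ_eq_topZ {n : ℕ} (α γ : K) (φ : K → K) (u : Fin n → K) :
    dsasmZ n q α α γ γ φ u =
      topZ q (fun x => (α * q * x + α * q⁻¹ * x⁻¹) * φ x)
        (fun x => γ * sigmaFn (q ^ 2 * x ^ 2) * φ x) (List.ofFn u) := by
  classical
  have h := sum_confWeight_eq_triZ (q := q) (l := leftWeight q α α γ γ φ)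
    (kd := fun x => (α * q * x + α * q⁻¹ * x⁻¹) * φ x)
    (ko := fun x => γ * sigmaFn (q ^ 2 * x ^ 2) * φ x) rfl
    (funext fun x => by simp only [leftWeight]; ring) rfl rfl n u (fun _ => .up)
  rw [topZ, List.length_ofFn, ← List.ofFn_const, ← h, dsasmZ, sixV, Finset.sum_filter]
  refine Finset.sum_congr rfl fun C _ => ?_
  have htop : C.top = (fun _ => .up) ↔
      ∀ (i j : Fin n) (h : i ≤ j), i.1 = 0 → C.above i j h = VDir.up := by
    obtain _ | n := n
    · exact ⟨fun _ i => i.elim0, fun _ => funext fun j => j.elim0⟩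
    · constructor
      · intro hC i j hij hi
        obtain rfl : i = 0 := Fin.ext hi
        exact congrFun hC j
      · exact fun hC => funext fun j => hC 0 j (Fin.zero_le j) rfl
  rw [IsSixVertex, ← htop]
  by_cases hb : ∀ (i j : Fin n) (h : i < j),
    incomingCount (C.above i j h.le) (C.below i j h) (C.leftOf i j h) (C.rightOf i j h.le) = 2
  · simp only [hb, implies_true, true_and]
    exact if_congr Iff.rfl rfl rfl
  · rw [if_neg fun h => hb h.1]
    push Not at hb
    obtain ⟨i, j, hij, hb⟩ := hb
    have : confWeight q (leftWeight q α α γ γ φ) u C = 0 := by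
      refine mul_eq_zero_of_right _ (Finset.prod_eq_zero (Finset.mem_univ i)
        (Finset.prod_eq_zero (Finset.mem_univ j) ?_))
      rw [dif_pos hij, bulkWeight_eq_zero hb]
    rw [this, ite_self]

theorem triZ_congr {R : Type*} [CommRing R] [Algebra K R] {kd ko kd' ko' : K → R} :
    ∀ us : List K, (∀ x ∈ us, kd x = kd' x ∧ ko x = ko' x) →
      triZ q kd ko us = triZ q kd' ko' us
  | [], _ => by
    funext as
    cases as <;> simp
  | u :: us, h => by
    funext as
    obtain ⟨h1, h2⟩ := h u (by simp)
    have ih := triZ_congr us fun x hx => h x (List.mem_cons_of_mem u hx)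
    obtain _ | ⟨a, as⟩ := as
    · simp
    · cases a <;> simp [h1, h2, ih]

/-- The factorisation σ(q²u²) = σ(qu)(qu + q̄ū) lets φ cancel. -/
theorem specZ_eq_topZ {n : ℕ} (hq : q ≠ 0) (s : K) (u : Fin n → K)
    (hu : ∀ i, u i ≠ 0 ∧ q ^ 2 * u i ^ 2 + 1 ≠ 0) :
    specZ n q s u = topZ q (fun _ => s) (wtO q) (List.ofFn u) := by
  rw [specZ, dsasmZ_eq_topZ, topZ, topZ]
  refine congrFun (triZ_congr _ fun x hx => ?_) _
  obtain ⟨i, rfl⟩ := (List.mem_ofFn' _ _).1 hx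
  obtain ⟨h0, h1⟩ := hu i
  have h2 : q * u i + q⁻¹ * (u i)⁻¹ ≠ 0 := by
    intro h
    field_simp at h
    exact h1 (h.trans (mul_zero _))
  constructor
  · field_simp
  · have : sigmaFn (q ^ 2 * u i ^ 2) = sigmaFn (q * u i) * (q * u i + q⁻¹ * (u i)⁻¹) := by
      simp only [sigmaFn, mul_inv]
      ring
    rw [this, wtO, mul_assoc, mul_assoc, mul_one_div_cancel h2]
    ring

open Polynomial in
theorem eval_triZ (s : K) : ∀ (us : List K) (as : List VDir),
    (triZ q (fun _ => (X : K[X])) (fun u => C (wtO q u)) us as).eval s =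
      triZ q (fun _ => s) (wtO q) us as
  | [], [] => by simp
  | [], a :: as => by simp
  | u :: us, [] => by simp
  | u :: us, a :: as => by
    have h := fun r => map_rowOp q u (leval s) r us as
      (triZ q (fun _ => (X : K[X])) (fun u => C (wtO q u)) us)
    simp only [leval_apply, eval_triZ s us] at h
    cases a <;> simp [h]

theorem eval_polyZ (s : K) (us : List K) :
    (polyZ q us).eval s = topZ q (fun _ => s) (wtO q) us := eval_triZ s _ _

end Configurations

/-! ### Specialisation at (u, ū, 1) -/

section Specialization

open Polynomial

variable {K : Type*} [Field K] {q I : K} {n : ℕ}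

theorem ofFn_oddArgs (u : Fin n → K) : List.ofFn (oddArgs u) =
    List.ofFn u ++ (List.ofFn u).map (·⁻¹) ++ [1] := by
  rw [List.ofFn_succ', List.concat_eq_append]
  simp [oddArgs, List.ofFn_fin_append, List.map_ofFn, Function.comp_def]

theorem ofFn_evenArgs (u : Fin n → K) (c : K) : List.ofFn (evenArgs u c) =
    List.ofFn (oddArgs u) ++ [c] := by
  rw [List.ofFn_succ', List.concat_eq_append]
  simp [evenArgs]

theorem mem_ofFn_oddArgs {u : Fin n → K} {x : K} :
    x ∈ List.ofFn (oddArgs u) ↔ ((∃ i, u i = x) ∨ ∃ i, (u i)⁻¹ = x) ∨ x = 1 := by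
  rw [ofFn_oddArgs]
  simp [List.mem_ofFn', or_assoc]

theorem prod_map_oddArgs (u : Fin n → K) (f : K → K) :
    ((List.ofFn (oddArgs u)).map f).prod = (∏ i, f (u i) * f (u i)⁻¹) * f 1 := by
  rw [ofFn_oddArgs]
  simp [List.map_ofFn, List.prod_ofFn, Finset.prod_mul_distrib, Function.comp_def, mul_assoc]

theorem map_inv_oddArgs_perm (u : Fin n → K) :
    ((List.ofFn (oddArgs u)).map (·⁻¹)).Perm (List.ofFn (oddArgs u)) := by
  rw [ofFn_oddArgs]
  simp only [List.map_append, List.map_map, Function.comp_def, inv_inv, List.map_id', List.map_cons,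
    inv_one, List.map_nil]
  exact List.perm_append_comm.append_right _

theorem sigmaFn_mul_sigmaFn_inv (hq : q ^ 2 + q⁻¹ ^ 2 = 1) {x : K} (hx : x ≠ 0) :
    sigmaFn (q * x) * sigmaFn (q * x⁻¹) = -(x ^ 2 + x⁻¹ ^ 2 - 1) := by
  have h3 := mul_inv_cancel₀ (ne_zero_of_sixth hq)
  have h4 := mul_inv_cancel₀ hx
  simp only [sigmaFn, mul_inv, inv_inv]
  linear_combination (q ^ 2 + q⁻¹ ^ 2) * h4 + hq - (x ^ 2 + x⁻¹ ^ 2) * h3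

variable [CharZero K]

/-- The argument list is closed under inversion, so the two summands of `linSum` are equal. Moreover
u²+ū²-1 = -σ(qu)σ(q/u), which is nonzero because neither u nor ū squares to q². -/
theorem linZ_oddArgs (hq : q ^ 2 + q⁻¹ ^ 2 = 1) (hI : I ^ 2 = -1) (u : Fin n → K)
    (h0 : ∀ x ∈ List.ofFn (oddArgs u), x ≠ 0)
    (hd : ((List.ofFn (oddArgs u)).map (· ^ 2)).Nodup)
    (h1 : ∀ x ∈ List.ofFn (oddArgs u), x ^ 2 ≠ -1)
    (h2 : ∀ x ∈ List.ofFn (oddArgs u), x ^ 2 ≠ q ^ 2) :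
    (∀ i, u i ^ 2 + (u i)⁻¹ ^ 2 - 1 ≠ 0) ∧
    linZ q (List.ofFn (oddArgs u)) * (∏ i, (u i ^ 2 + (u i)⁻¹ ^ 2 - 1)) =
      3 ^ n * (∏ i, (u i + (u i)⁻¹) ^ 2) * offZ q (I :: List.ofFn (oddArgs u)) := by
  have hq0 := ne_zero_of_sixth hq
  have hs := sigmaFn_ne_zero_of_sixth hq
  have h := linSum_eq hq hI n (List.ofFn (oddArgs u)) (by simp; ring) h0 hd h1 h2
  have hu0 : ∀ i, u i ≠ 0 := fun i => h0 _ (mem_ofFn_oddArgs.2 (.inl (.inl ⟨i, rfl⟩)))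
  have he := fun i => sigmaFn_mul_sigmaFn_inv hq (hu0 i)
  have hz : ∀ x ∈ List.ofFn (oddArgs u), sigmaFn (q * x⁻¹) ≠ 0 := by
    intro x hx
    have hx0 := h0 x hx
    rw [Ne, sigmaFn_eq_zero_iff (by positivity), mul_pow, inv_pow, mul_inv_eq_one₀ (by positivity)]
    exact (h2 x hx).symm
  have hi : ∀ i, u i ^ 2 + (u i)⁻¹ ^ 2 - 1 ≠ 0 := by
    intro i hi
    have h3 := hz _ (mem_ofFn_oddArgs.2 (.inl (.inl ⟨i, rfl⟩)))
    have h4 := hz _ (mem_ofFn_oddArgs.2 (.inl (.inr ⟨i, rfl⟩)))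
    rw [inv_inv] at h4
    have := he i
    rw [hi, neg_zero] at this
    exact mul_ne_zero h4 h3 this
  refine ⟨hi, ?_⟩
  have h0' : ∀ x ∈ (List.ofFn (oddArgs u)).map (·⁻¹), x ≠ 0 :=
    fun x hx => h0 x ((map_inv_oddArgs_perm u).mem_iff.1 hx)
  rw [linSum, linZ_perm hq (map_inv_oddArgs_perm u) h0', offExt, prod_map_oddArgs, prod_map_oddArgs,
    prod_map_oddArgs] at h
  simp only [inv_inv, inv_one, mul_one, mul_comm (sigmaFn (q * (_)⁻¹)), he, add_comm (_)⁻¹ (_),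
    Finset.prod_neg, Finset.card_univ, Fintype.card_fin, ← sq] at h
  have h2' : (2 : K) ≠ 0 := two_ne_zero
  have hn : ((-1 : K) ^ n) ≠ 0 := pow_ne_zero n (neg_ne_zero.2 one_ne_zero)
  rw [show (-3 : K) ^ n = (-1) ^ n * 3 ^ n by rw [← mul_pow]; norm_num] at h
  -- The 2 cancelled comes from the equal summands on one side and from u+ū at u = 1 on the other.
  refine mul_left_cancel₀ (mul_ne_zero (mul_ne_zero h2' hn) hs) ?_
  linear_combination h

/-- The even partition function carries the boundary weights ∏(u²+ū²-1) and σ(qi)/σ(q): the former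
make the denominator a square, and `c` absorbs the latter. -/
theorem specZ_oddArgs_evenArgs (hq : q ^ 2 + q⁻¹ ^ 2 = 1) (hI : I ^ 2 = -1) (u : Fin n → K)
    (h0 : ∀ x ∈ List.ofFn (oddArgs u), x ≠ 0)
    (hd : ((List.ofFn (oddArgs u)).map (· ^ 2)).Nodup)
    (h1 : ∀ x ∈ List.ofFn (oddArgs u), x ^ 2 ≠ -1)
    (h2 : ∀ x ∈ List.ofFn (oddArgs u), x ^ 2 ≠ q ^ 2)
    (h3 : ∀ x ∈ List.ofFn (oddArgs u), q ^ 2 * x ^ 2 + 1 ≠ 0)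
    {c : K} (hc : c * wtO q I = 3 ^ n) :
    ∃ P : K[X], (∀ s, specZ (n + n + 1) q s (oddArgs u) = s * P.eval s) ∧
      P.eval 0 = c * (∏ i, (u i + (u i)⁻¹) ^ 2 / (u i ^ 2 + (u i)⁻¹ ^ 2 - 1) ^ 2) *
        specZ (n + n + 1 + 1) q 0 (evenArgs u I) := by
  have hq0 := ne_zero_of_sixth hq
  have hs := sigmaFn_ne_zero_of_sixth hq
  have hI0 : I ≠ 0 := by rintro rfl; simp at hI
  have hq1 : q ^ 2 ≠ 1 := fun h => by
    have := pow_four_of_sixth hq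
    have : (1 : K) = 0 := by linear_combination this - q ^ 2 * h
    exact one_ne_zero this
  -- The constant coefficient vanishes in odd order, so `divX` is the exact quotient by s, and its
  -- value at 0 is `linZ`.
  refine ⟨(polyZ q (List.ofFn (oddArgs u))).divX, fun s => ?_, ?_⟩
  · have hz := offZ_eq_zero_of_odd hq n (List.ofFn (oddArgs u)) (by simp; ring) h0 hd
    rw [specZ_eq_topZ hq0 s _ fun i => ⟨h0 _ ((List.mem_ofFn' _ _).2 ⟨i, rfl⟩),
      h3 _ ((List.mem_ofFn' _ _).2 ⟨i, rfl⟩)⟩, ← eval_polyZ]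
    conv_lhs => rw [← X_mul_divX_add (polyZ q (List.ofFn (oddArgs u)))]
    rw [coeff_zero_polyZ, hz]
    simp
  · have hcond : ∀ i, evenArgs u I i ≠ 0 ∧ q ^ 2 * evenArgs u I i ^ 2 + 1 ≠ 0 := by
      intro i
      have hi : evenArgs u I i ∈ List.ofFn (evenArgs u I) := (List.mem_ofFn' _ _).2 ⟨i, rfl⟩
      rw [ofFn_evenArgs, List.mem_append, List.mem_singleton] at hi
      rcases hi with hi | hi
      · exact ⟨h0 _ hi, h3 _ hi⟩
      · rw [hi, hI]
        exact ⟨hI0, fun h => hq1 (by linear_combination -h)⟩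
    obtain ⟨hg, h⟩ := linZ_oddArgs hq hI u h0 hd h1 h2
    have hp : (I :: List.ofFn (oddArgs u)).Perm (List.ofFn (evenArgs u I)) := by
      rw [ofFn_evenArgs]
      exact (List.perm_append_singleton _ _).symm
    rw [specZ_eq_topZ hq0 0 _ hcond, ← eval_polyZ, ← coeff_zero_eq_eval_zero,
      ← coeff_zero_eq_eval_zero, coeff_zero_polyZ,
      ← offZ_perm hq hp (List.forall_mem_cons.2 ⟨hI0, h0⟩), ← (hp.map (wtO q)).prod_eq,
      List.map_cons, List.prod_cons, prod_map_oddArgs, coeff_divX]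
    have hw : ∀ i, wtO q (u i) * wtO q (u i)⁻¹ = u i ^ 2 + (u i)⁻¹ ^ 2 - 1 := by
      intro i
      rw [wtO, wtO, div_mul_div_comm, sigmaFn_mul_sigmaFn_inv hq
        (h0 _ (mem_ofFn_oddArgs.2 (.inl (.inl ⟨i, rfl⟩)))), ← sq, sigmaFn_sq_of_sixth hq,
        neg_div_neg_eq, div_one]
    have hw1 : wtO q 1 = 1 := by rw [wtO, mul_one, div_self hs]
    have hprod : ∏ i, (u i ^ 2 + (u i)⁻¹ ^ 2 - 1) ≠ 0 := Finset.prod_ne_zero_iff.2 fun i _ => hg i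
    simp only [hw, hw1, Finset.prod_div_distrib, Finset.prod_pow] at h ⊢
    refine mul_right_cancel₀ hprod (h.trans ?_)
    generalize ∏ i, (u i ^ 2 + (u i)⁻¹ ^ 2 - 1) = G at hprod ⊢
    generalize ∏ i, (u i + (u i)⁻¹) = S
    field_simp
    linear_combination (-S ^ 2) * offZ q (I :: List.ofFn (oddArgs u)) * hc

end Specialization

/-! ### The constant ε√3 -/

theorem sigmaFn_map {K L : Type*} [Field K] [Field L] (f : K →+* L) (x : K) :
    f (sigmaFn x) = sigmaFn (f x) := by
  simp [sigmaFn]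

theorem wtO_map {K L : Type*} [Field K] [Field L] (f : K →+* L) (q x : K) :
    f (wtO q x) = wtO (f q) (f x) := by
  simp [wtO, sigmaFn_map]

theorem rpow_mul_sqrt_three (n : ℕ) :
    (3 : ℝ) ^ ((2 * (n : ℝ) - 1) / 2) * √3 = 3 ^ n := by
  rw [Real.sqrt_eq_rpow, ← Real.rpow_add (by norm_num), ← Real.rpow_natCast]
  congr 1
  ring

/-- σ(qi)/σ(q) = i(q²+1)/(q²-1), and the equation for q gives q² = 1/2 + ε(√3/2)i. -/
theorem wtO_I_of_sixth {q : ℂ} (hq : q ^ 2 + q⁻¹ ^ 2 = 1) :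
    (if 0 < (q ^ 2).im then 1 else -1) * wtO q Complex.I = (√3 : ℝ) := by
  have hq0 := ne_zero_of_sixth hq
  have hs := sigmaFn_ne_zero_of_sixth hq
  have h4 := pow_four_of_sixth hq
  have hre : (q ^ 2).re = 1 / 2 ∧ (q ^ 2).im ^ 2 = 3 / 4 := by
    have h5 : (q ^ 2) ^ 2 = q ^ 2 - 1 := by linear_combination h4
    have e1 := congrArg Complex.re h5
    have e2 := congrArg Complex.im h5
    rw [sq (q ^ 2), Complex.mul_re, Complex.sub_re, Complex.one_re] at e1
    rw [sq (q ^ 2), Complex.mul_im, Complex.sub_im, Complex.one_im] at e2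
    have e3 : (q ^ 2).re = 1 / 2 := by
      rcases eq_or_ne (q ^ 2).im 0 with h | h
      · rw [h] at e1
        nlinarith [sq_nonneg ((q ^ 2).re - 1 / 2)]
      · refine mul_right_cancel₀ h ?_
        linarith
    refine ⟨e3, ?_⟩
    rw [e3] at e1
    linarith
  have him : (q ^ 2).im = (if 0 < (q ^ 2).im then 1 else -1) * (√3 / 2) := by
    have h3 : √3 ^ 2 = (3 : ℝ) := Real.sq_sqrt (by norm_num)
    have h6 : 0 < √(3 : ℝ) := by positivity
    split_ifs with h
    · nlinarith
    · nlinarith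
  have hz : q ^ 2 = 1 / 2 + (if 0 < (q ^ 2).im then 1 else -1) * ((√3 : ℝ) / 2) * Complex.I := by
    apply Complex.ext
    · rw [hre.1]; split_ifs <;> simp
    · conv_lhs => rw [him]
      split_ifs <;> simp
  have h3 : ((√3 : ℝ) : ℂ) ^ 2 = 3 := by
    rw [← Complex.ofReal_pow, Real.sq_sqrt (by norm_num)]; norm_num
  have hI := Complex.I_sq
  have hε : (if 0 < (q ^ 2).im then (1 : ℂ) else -1) ^ 2 = 1 := by split_ifs <;> norm_num
  generalize (if 0 < (q ^ 2).im then (1 : ℂ) else -1) = ε at hz hε ⊢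
  rw [wtO, ← mul_div_assoc, div_eq_iff hs]
  refine mul_left_cancel₀ hq0 ?_
  have e1 : q * sigmaFn q = q ^ 2 - 1 := by
    rw [sigmaFn, mul_sub, mul_inv_cancel₀ hq0, sq]
  have e2 : q * sigmaFn (q * Complex.I) = Complex.I * (q ^ 2 + 1) := by
    rw [sigmaFn, mul_inv, Complex.inv_I]
    linear_combination Complex.I * mul_inv_cancel₀ hq0
  generalize ((√3 : ℝ) : ℂ) = r at *
  linear_combination ε * e2 - r * e1 + (ε * Complex.I - r) * hz + (r / 2) * hI + (r / 2) * Complex.I ^ 2 * hε - ε * Complex.I / 2 * h3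

/-! ### Genericity of the indeterminates -/

section Generic

variable {n : ℕ}

theorem algebraMap_ne_of_eval_ne (x : Fin n → ℂ) {p p' : MvPolynomial (Fin n) ℂ}
    (h : MvPolynomial.eval x p ≠ MvPolynomial.eval x p') :
    algebraMap (MvPolynomial (Fin n) ℂ) (RatField n) p ≠ algebraMap _ (RatField n) p' :=
  fun e => h (congrArg _ (IsFractionRing.injective _ _ e))

theorem algebraMap_C_ratField (a : ℂ) :
    algebraMap (MvPolynomial (Fin n) ℂ) (RatField n) (MvPolynomial.C a) =
      algebraMap ℂ (RatField n) a := by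
  rw [IsScalarTower.algebraMap_apply ℂ (MvPolynomial (Fin n) ℂ) (RatField n),
    MvPolynomial.algebraMap_eq]

/-- Evaluation at the point with all coordinates 2 separates the two sides, hence the excluded value
4. -/
theorem indet_sq_ne_algebraMap {a : ℂ} (ha : a ≠ 4) (i : Fin n) :
    indet n i ^ 2 ≠ algebraMap ℂ (RatField n) a := by
  rw [indet, ← map_pow, ← algebraMap_C_ratField]
  refine algebraMap_ne_of_eval_ne (fun _ => 2) ?_
  simp only [map_pow, MvPolynomial.eval_X, MvPolynomial.eval_C]
  norm_num
  exact ha.symm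

theorem indet_ne_zero (i : Fin n) : indet n i ≠ 0 := by
  intro h
  have := indet_sq_ne_algebraMap (a := 0) (by norm_num) i
  simp [h] at this

theorem indet_sq_injective : Function.Injective fun i => indet n i ^ 2 := by
  intro i j h
  by_contra hij
  refine algebraMap_ne_of_eval_ne (n := n) (p := .X i ^ 2) (p' := .X j ^ 2)
    (fun k => if k = i then 2 else 1) ?_ (by simpa [indet] using h)
  simp [Ne.symm hij]
  norm_num

theorem indet_sq_ne_inv_sq (i j : Fin n) : indet n i ^ 2 ≠ (indet n j)⁻¹ ^ 2 := by
  intro h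
  rw [inv_pow, ← mul_eq_one_iff_eq_inv₀ (pow_ne_zero 2 (indet_ne_zero j))] at h
  refine algebraMap_ne_of_eval_ne (n := n) (p := .X i ^ 2 * .X j ^ 2) (p' := 1)
    (fun _ => 2) ?_ (by simpa [indet] using h)
  simp
  norm_num

/-- If `a ≠ 1, 4, 1/4`, then `a` is not the square of an element of the sequence
`u_1, …, u_n, 1/u_1, …, 1/u_n, 1`. -/
theorem sq_ne_of_mem_oddArgs {a : ℂ} (h1 : a ≠ 1) (h4 : a ≠ 4) (h5 : a⁻¹ ≠ 4) {x : RatField n}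
    (hx : x ∈ List.ofFn (oddArgs (indet n))) : x ^ 2 ≠ algebraMap ℂ (RatField n) a := by
  rcases mem_ofFn_oddArgs.1 hx with (⟨i, rfl⟩ | ⟨i, rfl⟩) | rfl
  · exact indet_sq_ne_algebraMap h4 i
  · rw [inv_pow]
    intro h
    exact indet_sq_ne_algebraMap h5 i (by rw [map_inv₀, ← h, inv_inv])
  · rw [one_pow, ← map_one (algebraMap ℂ (RatField n))]
    exact fun h => h1 ((algebraMap ℂ (RatField n)).injective h.symm)

theorem nodup_sq_oddArgs_indet :
    ((List.ofFn (oddArgs (indet n))).map (· ^ 2)).Nodup := by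
  have h1 : ∀ i, indet n i ^ 2 ≠ 1 := fun i => by
    simpa using indet_sq_ne_algebraMap (a := 1) (by norm_num) i
  rw [ofFn_oddArgs, List.map_append, List.map_append, List.map_map, List.map_ofFn, List.map_ofFn]
  refine List.Nodup.append (List.Nodup.append (List.nodup_ofFn.2 indet_sq_injective)
    (List.nodup_ofFn.2 fun i j h => indet_sq_injective ?_) ?_) (by simp) ?_
  · simpa using h
  · intro x hx hx'
    obtain ⟨i, rfl⟩ := (List.mem_ofFn' _ _).1 hx
    obtain ⟨j, h⟩ := (List.mem_ofFn' _ _).1 hx'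
    exact indet_sq_ne_inv_sq i j h.symm
  · simp only [List.map_cons, List.map_nil, one_pow, List.disjoint_singleton, List.mem_append,
      List.mem_ofFn']
    rintro (⟨i, h⟩ | ⟨i, h⟩)
    · exact h1 i h
    · exact h1 i (by simpa using h)

end Generic

/-! ### Assembly over the field of rational functions -/

theorem mainTheorem6 (n : ℕ) (q : ℂ) (hq : q ^ 2 + (q⁻¹) ^ 2 = 1) :
    ∃ P : Polynomial (RatField n),
      (∀ s : RatField n,
        specZ (n + n + 1) (algebraMap ℂ (RatField n) q) s (oddArgs (indet n)) = s * P.eval s) ∧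
      P.eval 0 =
        (if 0 < (q ^ 2).im then 1 else -1) *
          algebraMap ℂ (RatField n) (((3 : ℝ) ^ ((2 * (n : ℝ) - 1) / 2) : ℝ) : ℂ) *
          (∏ i : Fin n, (indet n i + (indet n i)⁻¹) ^ 2 /
            ((indet n i) ^ 2 + ((indet n i)⁻¹) ^ 2 - 1) ^ 2) *
          specZ (n + n + 1 + 1) (algebraMap ℂ (RatField n) q) 0
            (evenArgs (indet n) (algebraMap ℂ (RatField n) Complex.I)) := by
  have : CharZero (RatField n) :=
    charZero_of_injective_algebraMap (algebraMap ℂ (RatField n)).injective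
  have h4 := pow_four_of_sixth hq
  -- q² is a root of c² - c + 1, which excludes each exceptional rational value below.
  have hne : ∀ c : ℂ, c ^ 2 - c + 1 ≠ 0 → q ^ 2 ≠ c := by
    rintro c hc rfl
    exact hc (by linear_combination h4)
  have hqi : (q ^ 2)⁻¹ = 1 - q ^ 2 := by linear_combination hq
  have hm : ∀ {a : ℂ}, a ≠ 1 → a ≠ 4 → a⁻¹ ≠ 4 → ∀ x ∈ List.ofFn (oddArgs (indet n)),
    x ^ 2 ≠ algebraMap ℂ (RatField n) a := fun h1 h4 h5 _ hx => sq_ne_of_mem_oddArgs h1 h4 h5 hx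
  refine specZ_oddArgs_evenArgs ?_ ?_ (indet n) ?_ nodup_sq_oddArgs_indet ?_ ?_ ?_ ?_
  · rw [← map_inv₀, ← map_pow, ← map_pow, ← map_add, hq, map_one]
  · rw [← map_pow, Complex.I_sq, map_neg, map_one]
  · intro x hx h
    refine hm (a := 0) (by norm_num) (by norm_num) (by norm_num) x hx ?_
    rw [h, map_zero, zero_pow two_ne_zero]
  · simpa using hm (a := -1) (by norm_num) (by norm_num) (by norm_num)
  · rw [← map_pow]
    refine hm (hne _ (by norm_num)) (hne _ (by norm_num)) fun h => hne (-3) (by norm_num) ?_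
    linear_combination hqi - h
  · intro x hx h
    -- q²x² + 1 = 0 means x² = -q̄² = q² - 1.
    refine hm (a := q ^ 2 - 1) (fun h => hne 2 (by norm_num) ?_)
      (fun h => hne 5 (by norm_num) ?_) (fun h => hne (-4) (by norm_num) ?_) x hx ?_
    · linear_combination h
    · linear_combination h
    · rw [← neg_sub, ← hqi, inv_neg, inv_inv] at h
      linear_combination -h
    · have hq0 : algebraMap ℂ (RatField n) q ≠ 0 :=
        (map_ne_zero _).2 (ne_zero_of_sixth hq)
      have h5 := congrArg (algebraMap ℂ (RatField n)) h4
      simp only [map_sub, map_pow, map_one] at h5 ⊢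
      refine mul_left_cancel₀ (pow_ne_zero 2 hq0) ?_
      linear_combination h - h5
  · have h1 := congrArg (algebraMap ℂ (RatField n)) (wtO_I_of_sixth hq)
    have h2 := congrArg (fun x : ℝ => algebraMap ℂ (RatField n) (x : ℂ)) (rpow_mul_sqrt_three n)
    simp only [Complex.ofReal_mul, Complex.ofReal_pow, map_mul, map_pow, wtO_map, ← h1] at h2
    rw [apply_ite (algebraMap ℂ (RatField n))] at h2
    simp only [map_neg, map_one, Complex.ofReal_ofNat, map_ofNat] at h2
    rw [← h2]
    ring
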